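/- **Signature.** Terms are built from variables, names and the following function symbols, together with tuples $(T_1,\dots,T_n)$ for all $n$. *Public:* constants $\mathsf{p_s},\mathsf{p_d},\mathsf{true},\mathsf{false},\bot,\mathsf{os}$ and the message tags $\mathsf{reset\_req},\mathsf{reset\_resp},\mathsf{extend\_req},\mathsf{extend\_resp},\mathsf{ext\_channel},\mathsf{tag\_unseal},\mathsf{tag\_plain},\mathsf{drt\_req},\mathsf{drt\_resp}$; functions $\mathsf h/1$, $\mathsf{senc}/2$, $\mathsf{sdec}/2$, $\mathsf{seal}/2$, $\mathsf{prog}/1$, the readers $\mathsf{pcr},\mathsf{int},\mathsf{cache},\mathsf{stm},\mathsf{smi},\mathsf{init},\mathsf{pp},\mathsf{lock}$ (all unary), and the writers $\mathsf{reset},\mathsf{extend},\mathsf{set\_pcr},\mathsf{set\_int},\mathsf{set\_init},\mathsf{set\_pp},\mathsf{set\_lock}$ (ternary), $\mathsf{cache}$ (binary), $\mathsf{flush\_stm},\mathsf{flush\_smi}$ (unary). *Private:* $\mathsf{unseal}/2$, $\mathsf{get\_entry}/1$, $\mathsf{state}/4,\mathsf{tpm}/1,\mathsf{cpu}/2,\mathsf{smram}/2,\mathsf{drt}/3$,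 $\mathsf{tpm\_ch}/1$, the constants $\mathsf{tpm\_acc},\mathsf{cpu\_acc},\mathsf{cpu\_tpm}$, and infinitely many constants (program entry points), three of which are $\mathsf{Tinit},\mathsf{Tpp},\mathsf{Tstm}$. **Theory.** $\mathcal E_{\rm drt}=\mathcal E_{\rm data}\cup\mathcal E_{\rm prog}\cup\mathcal E_{\rm state}$ is given by the rewrite rules below; $U=_{\mathcal E}V$ means that $U,V$ have the same normal form, and a destructor is a symbol heading a left-hand side. $\mathcal E_{\rm data}$: $\mathsf{sdec}(\mathsf{senc}(v,k),k)\to v$, $\ \mathsf{unseal}(\mathsf{seal}(v,p),p)\to v$. $\ \mathcal E_{\rm prog}$: $\mathsf{get\_entry}(\mathsf{prog}(x))\to x$. $\mathcal E_{\rm state}$: platform states have the form $S=\mathsf{state}(\mathsf{tpm}(T_{PCR}),\mathsf{cpu}(T_{INT},T_{CACHE}),\mathsf{smram}(T_{STM},T_{SMI}),\mathsf{drt}(T_{INIT},T_{PP},T_{LOCK}))$. Each reader, applied to a state, rewrites to the corresponding component (only the one of the four blocks that contains this component needs to have the displayed form). Each writer rewrites to the state $S$ with one component changed (again only the blocks mentioned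 need to have the displayed form): $\mathsf{reset}(S,\mathsf{tpm\_acc},p)$ with $p\in\{\mathsf{p_s},\mathsf{p_d}\}$ sets $T_{PCR}:=p$; $\mathsf{extend}(S,\mathsf{tpm\_acc},v)$ sets $T_{PCR}:=\mathsf h((T_{PCR},v))$; $\mathsf{set\_pcr}(S,\mathsf{tpm\_acc},v)$ sets $T_{PCR}:=v$; $\mathsf{set\_int}(S,a,v)$ sets $T_{INT}:=v$ if $a=\mathsf{cpu\_acc}$, or if $T_{PP}=\mathsf{prog}(a)$ and $T_{LOCK}=\mathsf{true}$; $\mathsf{cache}(S,v)$ sets $T_{CACHE}:=v$; $\mathsf{flush\_stm}(S)$ sets $T_{STM}:=T_{CACHE}$ if $T_{LOCK}=\mathsf{false}$; $\mathsf{flush\_smi}(S)$ sets $T_{SMI}:=T_{CACHE}$; $\mathsf{set\_init}(S,\mathsf{cpu\_acc},v)$ sets $T_{INIT}:=v$; $\mathsf{set\_pp}(S,a,v)$ sets $T_{PP}:=v$ if $a=\mathsf{cpu\_acc}$, or $T_{INIT}=\mathsf{prog}(a)$, or $a=(z_1,z_2)$, $T_{INT}=\mathsf{true}$, $T_{STM}=\mathsf{prog}(z_1)$,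 $T_{SMI}=\mathsf{prog}(z_2)$; $\mathsf{set\_lock}(S,a,v)$ sets $T_{LOCK}:=v$ if $a=\mathsf{cpu\_acc}$, or $T_{PP}=\mathsf{prog}(a)$, or $a=(z_1,z_2)$, $T_{INT}=\mathsf{true}$, $T_{STM}=\mathsf{prog}(z_1)$, $T_{SMI}=\mathsf{prog}(z_2)$. **Deduction.** $S\vdash T$ is the least relation such that $S\vdash T$ if $T=_{\mathcal E}T'$ for some $T'\in S$; or $T=_{\mathcal E}f(T_1,\dots,T_n)$ with $f$ public (or a tuple) and all $S\vdash T_i$; or $T=_{\mathcal E}T_i$ for a component $T_i$ of a tuple with $S\vdash(T_1,\dots,T_n)$. **Processes** are $0$, $P\mid Q$, $!P$, $\mathsf{new}\,n;P$, $\mathsf{in}(U,A);P$, $\mathsf{out}(U,T);P$, $\mathsf{if}\ U=V\ \mathsf{then}\ P\ \mathsf{else}\ Q$ (a missing else-branch is $0$), $\mathsf{let}\ x=T\ \mathsf{in}\ P$. As in ProVerif, an input pattern $A$ is built by tupling from variables to be bound and equality tests $=\!T$. Configurations $(\mathcal N,\mathcal M,\mathcal P)$ consist of the names in use, the terms revealed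 to the attacker, and a multiset of processes. The steps are: $0$ disappears; $!P$ becomes $P,\,!P$; $P\mid Q$ becomes $P,Q$; $\mathsf{new}\,n;P$ becomes $P[n\mapsto n']$ with $n'\notin\mathcal N$, and $n'$ is added to $\mathcal N$; $\mathsf{out}(U,T);P$ and $\mathsf{in}(U',A);Q$ with $U=_{\mathcal E}U'$ and $T=_{\mathcal E}A\sigma$ become $P$, $Q\sigma$ ($\sigma$ normalized), and $T$ is added to $\mathcal M$ if $\mathcal M\vdash U$; a conditional becomes its first branch if $U=_{\mathcal E}V$ and its second branch otherwise; $\mathsf{let}\ x=T\ \mathsf{in}\ P$ becomes $P[x\mapsto T{\downarrow}]$ provided that the normal form $T{\downarrow}$ contains no destructor. $P\models\mathrm{Att}(T)$ means: there is a process $Q$ without private symbols and an execution $(\mathcal N_{\rm init},\emptyset,\{P\mid Q\})\to^*(\mathcal N',\mathcal M',\mathcal P')$ with $\mathcal M'\vdash T$, where $\mathcal N_{\rm init}$ is the set of free names of $P\mid Q$. For the name $k$ bound by a restriction in $P$, $\mathrm{Att}(k)$ refers to the fresh name created in this execution when that restriction of $P$ is executed. **The process** $\mathrm{DRT}=\mathrm{TPM}\mid\mathrm{EXEC}$.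 Below, a tag or a previously bound identifier inside an input pattern is an equality test; every other identifier is bound by the pattern. $\mathrm{TPM}={!\mathrm{TPM}_{R}}\mid{!\mathrm{TPM}_{E}}\mid{!\mathrm{TPM}_{U}}$, where $\mathrm{TPM}_R=(\mathsf{let}\ (ch,rv)=(\mathsf{cpu\_tpm},\mathsf{p_d})\ \mathsf{in}\ !R)\mid(\mathsf{let}\ (ch,rv)=(\mathsf{os},\mathsf{p_s})\ \mathsf{in}\ !R)$, $R=\mathsf{in}(ch,(\mathsf{reset\_req},n,s));\mathsf{let}\ s'=\mathsf{reset}(s,\mathsf{tpm\_acc},rv)\ \mathsf{in}\ \mathsf{out}(ch,(\mathsf{reset\_resp},n,s'))$; $\mathrm{TPM}_E=(\mathsf{let}\ ch=\mathsf{cpu\_tpm}\ \mathsf{in}\ !X)\mid(\mathsf{let}\ ch=\mathsf{os}\ \mathsf{in}\ !X)\mid{!(\mathsf{in}(\mathsf{cpu\_tpm},(\mathsf{ext\_channel},ch));!X)}$, $X=\mathsf{in}(ch,(\mathsf{extend\_req},n,s,v));\mathsf{let}\ s'=\mathsf{extend}(s,\mathsf{tpm\_acc},v)\ \mathsf{in}\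 \mathsf{out}(ch,(\mathsf{extend\_resp},n,s'))$; $\mathrm{TPM}_U=\mathsf{in}(\mathsf{os},s);\mathsf{if}\ \mathsf{lock}(s)=\mathsf{true}\ \mathsf{then}\ \mathsf{let}\ ch=\mathsf{tpm\_ch}(\mathsf{pp}(s))\ \mathsf{in}\ Y\ \mathsf{else}\ \mathsf{let}\ ch=\mathsf{os}\ \mathsf{in}\ Y$, $Y=\mathsf{in}(ch,(\mathsf{tag\_unseal},b));\mathsf{let}\ v=\mathsf{unseal}(b,\mathsf{pcr}(s))\ \mathsf{in}\ \mathsf{out}(ch,(\mathsf{tag\_plain},v))$. $\mathrm{EXEC}=\mathrm{CPU}\mid{!\mathrm{INIT}}\mid\mathrm{SETUP}\mid\mathrm{DATA}\mid{!\mathrm{PP}}$, where $\mathrm{CPU}={!\,}\mathsf{in}(\mathsf{os},(\mathsf{drt\_req},i,p,s));\ \mathsf{if}\ \mathsf{lock}(s)=\mathsf{false}\ \mathsf{then}\ \mathsf{let}\ s_0'=\mathsf{set\_int}(s,\mathsf{cpu\_acc},\mathsf{false})\ \mathsf{in}\ \mathsf{let}\ s_0=\mathsf{set\_lock}(s_0',\mathsf{cpu\_acc},\mathsf{true})\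 \mathsf{in}\ \mathsf{let}\ m=(\mathsf h(i),\mathsf h(\mathsf{stm}(s)))\ \mathsf{in}\ \mathsf{new}\,n;\ \mathsf{out}(\mathsf{cpu\_tpm},(\mathsf{reset\_req},n,s_0));\ \mathsf{in}(\mathsf{cpu\_tpm},(\mathsf{reset\_resp},n,s_1));\ \mathsf{out}(\mathsf{cpu\_tpm},(\mathsf{extend\_req},n,s_1,m));\ \mathsf{in}(\mathsf{cpu\_tpm},(\mathsf{extend\_resp},n,s_2));\ \mathsf{let}\ s_3=\mathsf{set\_init}(s_2,\mathsf{cpu\_acc},i)\ \mathsf{in}\ \mathsf{let}\ e=\mathsf{get\_entry}(i)\ \mathsf{in}\ \mathsf{out}(e,(n,s_3,\mathsf{tpm\_ch}(i),p));\ \mathsf{out}(\mathsf{cpu\_tpm},(\mathsf{ext\_channel},\mathsf{tpm\_ch}(i)));\ \mathsf{in}(e,(\mathsf{drt\_resp},n,s_4));\ \mathsf{let}\ e'=\mathsf{get\_entry}(\mathsf{pp}(s_4))\ \mathsf{in}\ \mathsf{out}(e',(s_4,\mathsf{tpm\_ch}(\mathsf{prog}(e'))));\ \mathsf{out}(\mathsf{cpu\_tpm},(\mathsf{ext\_channel},\mathsf{tpm\_ch}(\mathsf{prog}(e'))))$;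 $\mathrm{INIT}=\mathsf{out}(\mathsf{os},\mathsf{prog}(\mathsf{Tinit}));\ \mathsf{out}(\mathsf{os},\mathsf{prog}(\mathsf{Tstm}));\ \mathsf{in}(\mathsf{Tinit},(n,s,c,p));\ \mathsf{let}\ m=\mathsf h(p)\ \mathsf{in}\ \mathsf{new}\,n_1;\ \mathsf{out}(c,(\mathsf{extend\_req},n_1,s,m));\ \mathsf{in}(c,(\mathsf{extend\_resp},n_1,s'));\ \mathsf{let}\ s''=\mathsf{set\_pp}(s',\mathsf{Tinit},p)\ \mathsf{in}\ \mathsf{out}(\mathsf{Tinit},(\mathsf{drt\_resp},n,s''));\ \mathsf{out}(\mathsf{os},s'')$; $\mathrm{PP}=\mathsf{out}(\mathsf{os},\mathsf{prog}(\mathsf{Tpp}));\ \mathsf{in}(\mathsf{Tpp},(s_0,c));\ \mathsf{let}\ s=\mathsf{set\_int}(s_0,\mathsf{Tpp},\mathsf{true})\ \mathsf{in}\ \mathsf{out}(\mathsf{os},s);\ \mathsf{in}(\mathsf{os},x_1);\ \mathsf{in}(\mathsf{os},x_2);\ \mathsf{out}(c,(\mathsf{tag\_unseal},x_1));\ \mathsf{in}(c,(\mathsf{tag\_plain},x_k));\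 \mathsf{let}\ m=\mathsf{sdec}(x_2,x_k)\ \mathsf{in}\ \mathsf{out}(\mathsf{os},m);\ \mathsf{new}\,r;\ \mathsf{out}(c,(\mathsf{extend\_req},r,s,\bot));\ \mathsf{in}(c,(\mathsf{extend\_resp},r,s'));\ \mathsf{let}\ s''=\mathsf{set\_lock}(s',\mathsf{Tpp},\mathsf{false})\ \mathsf{in}\ \mathsf{out}(\mathsf{os},s'')$; $\mathrm{SETUP}=\mathsf{in}(\mathsf{os},x_{stm});\ \mathsf{in}(\mathsf{os},x_{smi});\ \mathsf{out}(\mathsf{os},\mathsf{state}(\mathsf{tpm}(\mathsf{p_s}),\mathsf{cpu}(\mathsf{true},\bot),\mathsf{smram}(x_{stm},x_{smi}),\mathsf{drt}(\bot,\bot,\mathsf{false})));\ \mathsf{in}(\mathsf{os},i);\ \mathsf{in}(\mathsf{os},p);\ \mathsf{in}(\mathsf{os},s);\ \mathsf{out}(\mathsf{os},(\mathsf{drt\_req},i,p,s))$; $\mathrm{DATA}=\mathsf{new}\,k_{pp};\ \mathsf{new}\,hi_{pp};\ \mathsf{out}(\mathsf{os},\mathsf{senc}(hi_{pp},k_{pp}));\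 \mathsf{let}\ x=\mathsf{seal}(k_{pp},\mathsf{hchain})\ \mathsf{in}\ \mathsf{out}(\mathsf{os},x)$, with $\mathsf{hchain}=\mathsf h((\mathsf h((\mathsf{p_d},(\mathsf h(\mathsf{prog}(\mathsf{Tinit})),\mathsf h(\mathsf{prog}(\mathsf{Tstm}))))),\mathsf h(\mathsf{prog}(\mathsf{Tpp}))))$. **Theorem.** Modulo $\mathcal E_{\rm drt}$, the process $\mathrm{DRT}$ satisfies: 1. (Code integrity $\Phi_{int}$) For all terms $x,y,x_{stm},x_{smi},x_{init},x_{pp}$: if $\mathrm{DRT}\models\mathrm{Att}\big(\mathsf{state}(\mathsf{tpm}(\mathsf{hchain}),\mathsf{cpu}(x,y),\mathsf{smram}(x_{stm},x_{smi}),\mathsf{drt}(x_{init},x_{pp},\mathsf{true}))\big)$, then $(x_{init},x_{pp},x_{stm})=_{\mathcal E_{\rm drt}}(\mathsf{prog}(\mathsf{Tinit}),\mathsf{prog}(\mathsf{Tpp}),\mathsf{prog}(\mathsf{Tstm}))$. 2. (Data secrecy $\Phi_{sec}$) $\mathrm{DRT}\models\mathrm{Att}(k_{pp})$ does not hold. 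-/

import Mathlib

namespace DRT

/-! ## Terms and signature -/

/-- Variables: those written in the processes below, and infinitely many others. -/
inductive Var
  | ch | rv | nonce | nonce1 | rand | pfState | pfState0 | pfSt | newSt | newState | val | blob
  | init | pp | s0' | s0 | s1 | s2 | s3 | measure | einit | epp | tpmc | extSt
  | xSeal | xEnc | xK | mess | exts | ends | kpp | hipp | sealedKey
  | xInt | xCache | xStm | xSmi | xInit | xPp
  | other (n : ℕ)
  deriving DecidableEq

/-- Function symbols. -/
inductive Sym
  -- tuples `(T₁, …, Tₙ)`
  | tup (n : ℕ)
  -- cryptographic primitives and platform constants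
  | ps | pd | true | false | bot | h | senc | sdec | sealData | unsealData
  -- programs: `entry i` are the (infinitely many) private entry points
  | prog | entry (i : ℕ) | get_entry
  -- platform states
  | state | tpm | cpu | smram | drt
  -- read access
  | pcr | int | cache | stm | smi | init | pp | lock
  -- write access
  | tpm_acc | cpu_acc | reset | extend | set_pcr | set_int | set_cache | flush_stm | flush_smi
  | set_init | set_pp | set_lock
  -- channels
  | os | cpu_tpm | tpm_ch
  -- message tags
  | reset_req | reset_resp | extend_req | extend_resp | ext_channel
  | tag_unsealing | tag_plain | drt_req | drt_resp

def Sym.arity : Sym → ℕ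
  | .tup n => n
  | .h | .prog | .get_entry | .tpm | .tpm_ch => 1
  | .pcr | .int | .cache | .stm | .smi | .init | .pp | .lock => 1
  | .flush_stm | .flush_smi => 1
  | .senc | .sdec | .sealData | .unsealData | .cpu | .smram | .set_cache => 2
  | .drt | .reset | .extend | .set_pcr | .set_int | .set_init | .set_pp | .set_lock => 3
  | .state => 4
  | _ => 0

/-- The private symbols; every other symbol is public. -/
def Sym.IsPrivate : Sym → Prop
  | .unsealData | .entry _ | .get_entry => True
  | .state | .tpm | .cpu | .smram | .drt => True
  | .tpm_acc | .cpu_acc | .cpu_tpm | .tpm_ch => True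
  | _ => False

/-- Terms over variables, names (indexed by `ℕ`) and function symbols. -/
inductive Term
  | var (x : Var)
  | name (n : ℕ)
  | app (f : Sym) (ts : Fin f.arity → Term)

abbrev Subst := Var → Term

def Term.subst (σ : Subst) : Term → Term
  | .var x => σ x
  | .name n => .name n
  | .app f ts => .app f (fun i => (ts i).subst σ)

/-- The names that occur in a term. -/
def Term.names : Term → Set ℕ
  | .var _ => ∅
  | .name n => {n}
  | .app _ ts => ⋃ i, (ts i).names

/-- No private symbol occurs in the term. -/
def Term.IsPublic : Term → Prop
  | .var _ => True
  | .name _ => True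
  | .app f ts => ¬ f.IsPrivate ∧ ∀ i, (ts i).IsPublic

/-! ## Rewriting, equality modulo a theory, deduction

A theory `E` is given by the set of all instances `Uσ → Vσ` of its rewrite rules. -/

abbrev Theory := Term → Term → Prop

/-- One rewrite step, at any position. -/
inductive Rew (E : Theory) : Term → Term → Prop
  | root {U V : Term} : E U V → Rew E U V
  | arg (f : Sym) (ts : Fin f.arity → Term) (i : Fin f.arity) {U : Term} :
      Rew E (ts i) U → Rew E (.app f ts) (.app f (Function.update ts i U))

def Irred (E : Theory) (T : Term) : Prop := ∀ U, ¬ Rew E T U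

/-- `U` is a normal form `T↓` of `T`. -/
def IsNormalForm (E : Theory) (T U : Term) : Prop :=
  Relation.ReflTransGen (Rew E) T U ∧ Irred E U

/-- `U =_E V`: the normal forms of `U` and `V` coincide. -/
def EqE (E : Theory) (U V : Term) : Prop :=
  ∃ W, IsNormalForm E U W ∧ IsNormalForm E V W

/-- A destructor is a symbol at the head of a rewrite rule. -/
def IsDestructor (E : Theory) (f : Sym) : Prop := ∃ ts V, E (.app f ts) V

def NoDestructor (E : Theory) : Term → Prop
  | .var _ => True
  | .name _ => True
  | .app f ts => ¬ IsDestructor E f ∧ ∀ i, NoDestructor E (ts i)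

/-- The deduction relation `S ⊢_E T`. -/
inductive Deduces (E : Theory) (S : Set Term) : Term → Prop
  | ax {T' T : Term} : T' ∈ S → EqE E T' T → Deduces E S T
  | app {f : Sym} {ts : Fin f.arity → Term} {T : Term} : ¬ f.IsPrivate →
      (∀ i, Deduces E S (ts i)) → EqE E (.app f ts) T → Deduces E S T
  | proj {n : ℕ} {ts : Fin (Sym.tup n).arity → Term} (i : Fin (Sym.tup n).arity) {T : Term} :
      Deduces E S (.app (.tup n) ts) → EqE E (ts i) T → Deduces E S T

/-! ## The process calculus -/

/-- Input patterns, as in ProVerif: a variable to be bound, an equality test against a term,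
or a tuple of patterns. -/
inductive Pat
  | bind (x : Var)
  | test (T : Term)
  | tup {n : ℕ} (As : Fin n → Pat)

/-- The pattern read as a term. -/
def Pat.toTerm : Pat → Term
  | .bind x => .var x
  | .test T => T
  | .tup (n := n) As => .app (.tup n) (fun i => (As i).toTerm)

/-- The variables bound by a pattern. -/
def Pat.binds : Pat → Set Var
  | .bind x => {x}
  | .test _ => ∅
  | .tup As => ⋃ i, (As i).binds

/-- Processes. A restricted name is represented, in the body of the restriction, by the variable
that `new` binds; the names that occur in a process are its free names. -/
inductive Proc
  | nil
  | par (P Q : Proc)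
  | repl (P : Proc)
  | new (x : Var) (P : Proc)
  | inp (U : Term) (A : Pat) (P : Proc)
  | out (U T : Term) (P : Proc)
  | ite (U V : Term) (P Q : Proc)
  | letIn (x : Var) (T : Term) (P : Proc)

def Proc.names : Proc → Set ℕ
  | .nil => ∅
  | .par P Q => P.names ∪ Q.names
  | .repl P => P.names
  | .new _ P => P.names
  | .inp U A P => U.names ∪ A.toTerm.names ∪ P.names
  | .out U T P => U.names ∪ T.names ∪ P.names
  | .ite U V P Q => U.names ∪ V.names ∪ P.names ∪ Q.names
  | .letIn _ T P => T.names ∪ P.names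

/-- No private symbol occurs in the process. -/
def Proc.IsPublic : Proc → Prop
  | .nil => True
  | .par P Q => P.IsPublic ∧ Q.IsPublic
  | .repl P => P.IsPublic
  | .new _ P => P.IsPublic
  | .inp U A P => U.IsPublic ∧ A.toTerm.IsPublic ∧ P.IsPublic
  | .out U T P => U.IsPublic ∧ T.IsPublic ∧ P.IsPublic
  | .ite U V P Q => U.IsPublic ∧ V.IsPublic ∧ P.IsPublic ∧ Q.IsPublic
  | .letIn _ T P => T.IsPublic ∧ P.IsPublic

/-- Configurations `(N, M, 𝒫)`. A running process `Pσ` is kept as the pair `(σ, P)`. -/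
structure Config where
  N : Set ℕ
  M : Set Term
  procs : Multiset (Subst × Proc)

/-- `σ'` extends `σ` by (normalized) values for the variables bound by the pattern `A`, in such
a way that the message `T` is an instance of `A` modulo `E`. -/
def Matches (E : Theory) (σ : Subst) (A : Pat) (T : Term) (σ' : Subst) : Prop :=
  (∀ x, x ∉ A.binds → σ' x = σ x) ∧ (∀ x ∈ A.binds, Irred E (σ' x)) ∧
    EqE E T (A.toTerm.subst σ')

/-- Operational semantics. -/
inductive Step (E : Theory) : Config → Config → Prop
  | nil (N M Ps σ) : Step E ⟨N, M, (σ, .nil) ::ₘ Ps⟩ ⟨N, M, Ps⟩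
  | bang (N M Ps σ P) :
      Step E ⟨N, M, (σ, .repl P) ::ₘ Ps⟩ ⟨N, M, (σ, P) ::ₘ (σ, .repl P) ::ₘ Ps⟩
  | par (N M Ps σ P Q) :
      Step E ⟨N, M, (σ, .par P Q) ::ₘ Ps⟩ ⟨N, M, (σ, P) ::ₘ (σ, Q) ::ₘ Ps⟩
  | new (N M Ps σ x P) (n' : ℕ) : n' ∉ N →
      Step E ⟨N, M, (σ, .new x P) ::ₘ Ps⟩
        ⟨N ∪ {n'}, M, (Function.update σ x (.name n'), P) ::ₘ Ps⟩
  | comm (N M Ps) (σ U T P) (τ U' A Q) (τ' : Subst) :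
      EqE E (U.subst σ) (U'.subst τ) → Matches E τ A (T.subst σ) τ' →
      Step E ⟨N, M, (σ, .out U T P) ::ₘ (τ, .inp U' A Q) ::ₘ Ps⟩
        ⟨N, M ∪ {T' | Deduces E M (U.subst σ) ∧ T' = T.subst σ}, (σ, P) ::ₘ (τ', Q) ::ₘ Ps⟩
  | ifTrue (N M Ps σ U V P Q) : EqE E (U.subst σ) (V.subst σ) →
      Step E ⟨N, M, (σ, .ite U V P Q) ::ₘ Ps⟩ ⟨N, M, (σ, P) ::ₘ Ps⟩
  | ifFalse (N M Ps σ U V P Q) : ¬ EqE E (U.subst σ) (V.subst σ) →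
      Step E ⟨N, M, (σ, .ite U V P Q) ::ₘ Ps⟩ ⟨N, M, (σ, Q) ::ₘ Ps⟩
  | letIn (N M Ps σ x T P) (T' : Term) : IsNormalForm E (T.subst σ) T' → NoDestructor E T' →
      Step E ⟨N, M, (σ, .letIn x T P) ::ₘ Ps⟩ ⟨N, M, (Function.update σ x T', P) ::ₘ Ps⟩

/-- The execution relation `→*`. -/
abbrev Steps (E : Theory) : Config → Config → Prop := Relation.ReflTransGen (Step E)

/-- The configuration `(N_init, ∅, {P | Q})`, where `N_init` consists of the free names. -/
def initConfig (P Q : Proc) : Config :=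
  ⟨P.names ∪ Q.names, ∅, {(Term.var, .par P Q)}⟩

/-- `P ⊨_E Att(T)`: some attacker process, free of private symbols, learns `T` from `P`. -/
def Att (E : Theory) (P : Proc) (T : Term) : Prop :=
  ∃ Q : Proc, Q.IsPublic ∧ ∃ C : Config, Steps E (initConfig P Q) C ∧ Deduces E C.M T

/-- `P ⊨_E Att(T) ⟹ (U = V)`. -/
def AttImpliesEq (E : Theory) (P : Proc) (T U V : Term) : Prop :=
  ∀ σ : Subst, Att E P (T.subst σ) → EqE E (U.subst σ) (V.subst σ)

/-- `P ⊨_E Att(n)` for the name `n` restricted by the subprocess `new x; R` of `P`: in some run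
with an attacker, the attacker learns the fresh name `n` that is created when `new x; R` is
executed. (`R` should contain a private symbol, so that `new x; R` cannot stem from the
attacker.) -/
def AttNew (E : Theory) (P : Proc) (x : Var) (R : Proc) : Prop :=
  ∃ Q : Proc, Q.IsPublic ∧ ∃ (N : Set ℕ) (M : Set Term) (Ps : Multiset (Subst × Proc))
    (σ : Subst) (n : ℕ) (C : Config),
    Steps E (initConfig P Q) ⟨N, M, (σ, .new x R) ::ₘ Ps⟩ ∧ n ∉ N ∧
    Steps E ⟨N ∪ {n}, M, (Function.update σ x (.name n), R) ::ₘ Ps⟩ C ∧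
    Deduces E C.M (.name n)

/-- `P ⊨_E Att(n) ⟹ false`, for the name `n` restricted by the subprocess `new x; R` of `P`. -/
def AttNewImpliesFalse (E : Theory) (P : Proc) (x : Var) (R : Proc) : Prop :=
  AttNew E P x R → False

/-! ## Term constructors -/

abbrev V (x : Var) : Term := .var x
/-- A constant, i.e. a symbol of arity `0`. -/
abbrev K (f : Sym) (hf : f.arity = 0 := by rfl) : Term :=
  .app f (fun i => absurd i.isLt (by omega))
abbrev tup {n : ℕ} (ts : Fin n → Term) : Term := .app (.tup n) ts
abbrev h (a : Term) : Term := .app .h (![a] : Fin 1 → Term)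
abbrev senc (a b : Term) : Term := .app .senc (![a, b] : Fin 2 → Term)
abbrev sdec (a b : Term) : Term := .app .sdec (![a, b] : Fin 2 → Term)
abbrev sealData (a b : Term) : Term := .app .sealData (![a, b] : Fin 2 → Term)
abbrev unsealData (a b : Term) : Term := .app .unsealData (![a, b] : Fin 2 → Term)
abbrev prog (a : Term) : Term := .app .prog (![a] : Fin 1 → Term)
abbrev get_entry (a : Term) : Term := .app .get_entry (![a] : Fin 1 → Term)
abbrev state (a b c d : Term) : Term := .app .state (![a, b, c, d] : Fin 4 → Term)
abbrev tpm (a : Term) : Term := .app .tpm (![a] : Fin 1 → Term)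
abbrev cpu (a b : Term) : Term := .app .cpu (![a, b] : Fin 2 → Term)
abbrev smram (a b : Term) : Term := .app .smram (![a, b] : Fin 2 → Term)
abbrev drt (a b c : Term) : Term := .app .drt (![a, b, c] : Fin 3 → Term)
abbrev pcr (a : Term) : Term := .app .pcr (![a] : Fin 1 → Term)
abbrev int (a : Term) : Term := .app .int (![a] : Fin 1 → Term)
abbrev cache (a : Term) : Term := .app .cache (![a] : Fin 1 → Term)
abbrev stm (a : Term) : Term := .app .stm (![a] : Fin 1 → Term)
abbrev smi (a : Term) : Term := .app .smi (![a] : Fin 1 → Term)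
abbrev init (a : Term) : Term := .app .init (![a] : Fin 1 → Term)
abbrev pp (a : Term) : Term := .app .pp (![a] : Fin 1 → Term)
abbrev lock (a : Term) : Term := .app .lock (![a] : Fin 1 → Term)
abbrev reset (a b c : Term) : Term := .app .reset (![a, b, c] : Fin 3 → Term)
abbrev extend (a b c : Term) : Term := .app .extend (![a, b, c] : Fin 3 → Term)
abbrev set_pcr (a b c : Term) : Term := .app .set_pcr (![a, b, c] : Fin 3 → Term)
abbrev set_int (a b c : Term) : Term := .app .set_int (![a, b, c] : Fin 3 → Term)
/-- The binary symbol `cache`. -/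
abbrev set_cache (a b : Term) : Term := .app .set_cache (![a, b] : Fin 2 → Term)
abbrev flush_stm (a : Term) : Term := .app .flush_stm (![a] : Fin 1 → Term)
abbrev flush_smi (a : Term) : Term := .app .flush_smi (![a] : Fin 1 → Term)
abbrev set_init (a b c : Term) : Term := .app .set_init (![a, b, c] : Fin 3 → Term)
abbrev set_pp (a b c : Term) : Term := .app .set_pp (![a, b, c] : Fin 3 → Term)
abbrev set_lock (a b c : Term) : Term := .app .set_lock (![a, b, c] : Fin 3 → Term)
abbrev tpm_ch (a : Term) : Term := .app .tpm_ch (![a] : Fin 1 → Term)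

abbrev os : Term := K .os
abbrev cpu_tpm : Term := K .cpu_tpm
abbrev tpm_acc : Term := K .tpm_acc
abbrev cpu_acc : Term := K .cpu_acc
abbrev ps : Term := K .ps
abbrev pd : Term := K .pd
abbrev tt : Term := K .true
abbrev ff : Term := K .false
abbrev bot : Term := K .bot
/-- The private entry points of the trusted programs. -/
abbrev Tinit : Term := K (.entry 0)
abbrev Tpp : Term := K (.entry 1)
abbrev Tstm : Term := K (.entry 2)

/-! ## The equational theories -/

inductive Edata : Theory
  | sdec (v k) : Edata (sdec (senc v k) k) v
  | unsealData (v p) : Edata (unsealData (sealData v p) p) v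

inductive Eprog : Theory
  | get_entry (x) : Eprog (get_entry (prog x)) x

inductive Estate : Theory
  -- read access
  | pcr (y x₁ x₂ x₃) : Estate (pcr (state (tpm y) x₁ x₂ x₃)) y
  | int (x₁ y₁ y₂ x₂ x₃) : Estate (int (state x₁ (cpu y₁ y₂) x₂ x₃)) y₁
  | cache (x₁ y₁ y₂ x₂ x₃) : Estate (cache (state x₁ (cpu y₁ y₂) x₂ x₃)) y₂
  | stm (x₁ x₂ y₁ y₂ x₃) : Estate (stm (state x₁ x₂ (smram y₁ y₂) x₃)) y₁
  | smi (x₁ x₂ y₁ y₂ x₃) : Estate (smi (state x₁ x₂ (smram y₁ y₂) x₃)) y₂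
  | init (x₁ x₂ x₃ y₁ y₂ y₃) : Estate (init (state x₁ x₂ x₃ (drt y₁ y₂ y₃))) y₁
  | pp (x₁ x₂ x₃ y₁ y₂ y₃) : Estate (pp (state x₁ x₂ x₃ (drt y₁ y₂ y₃))) y₂
  | lock (x₁ x₂ x₃ y₁ y₂ y₃) : Estate (lock (state x₁ x₂ x₃ (drt y₁ y₂ y₃))) y₃
  -- write access
  | reset_ps (y x₁ x₂ x₃) :
      Estate (reset (state (tpm y) x₁ x₂ x₃) tpm_acc ps) (state (tpm ps) x₁ x₂ x₃)
  | reset_pd (y x₁ x₂ x₃) :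
      Estate (reset (state (tpm y) x₁ x₂ x₃) tpm_acc pd) (state (tpm pd) x₁ x₂ x₃)
  | extend (y x₁ x₂ x₃ v) :
      Estate (extend (state (tpm y) x₁ x₂ x₃) tpm_acc v) (state (tpm (h (tup ![y, v]))) x₁ x₂ x₃)
  | set_pcr (y x₁ x₂ x₃ v) :
      Estate (set_pcr (state (tpm y) x₁ x₂ x₃) tpm_acc v) (state (tpm v) x₁ x₂ x₃)
  | set_int_cpu (x₁ y₁ y₂ x₂ x₃ v) :
      Estate (set_int (state x₁ (cpu y₁ y₂) x₂ x₃) cpu_acc v) (state x₁ (cpu v y₂) x₂ x₃)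
  | set_int_pp (x₁ y z x₂ z₁ z₂ v) :
      Estate (set_int (state x₁ (cpu y z) x₂ (drt z₁ (prog z₂) tt)) z₂ v)
        (state x₁ (cpu v z) x₂ (drt z₁ (prog z₂) tt))
  | set_cache (x₁ y₁ y₂ x₂ x₃ v) :
      Estate (set_cache (state x₁ (cpu y₁ y₂) x₂ x₃) v) (state x₁ (cpu y₁ v) x₂ x₃)
  | flush_stm (x₁ y₁ v z₁ z₂ w₁ w₂) :
      Estate (flush_stm (state x₁ (cpu y₁ v) (smram z₁ z₂) (drt w₁ w₂ ff)))
        (state x₁ (cpu y₁ v) (smram v z₂) (drt w₁ w₂ ff))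
  | flush_smi (x₁ y₁ v z₁ z₂ x₂) :
      Estate (flush_smi (state x₁ (cpu y₁ v) (smram z₁ z₂) x₂))
        (state x₁ (cpu y₁ v) (smram z₁ v) x₂)
  | set_init (x₁ x₂ x₃ y₁ y₂ y₃ v) :
      Estate (set_init (state x₁ x₂ x₃ (drt y₁ y₂ y₃)) cpu_acc v)
        (state x₁ x₂ x₃ (drt v y₂ y₃))
  | set_pp_cpu (x₁ x₂ x₃ y₁ y₂ y₃ v) :
      Estate (set_pp (state x₁ x₂ x₃ (drt y₁ y₂ y₃)) cpu_acc v)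
        (state x₁ x₂ x₃ (drt y₁ v y₃))
  | set_pp_init (x₁ x₂ x₃ y₁ y₂ y₃ v) :
      Estate (set_pp (state x₁ x₂ x₃ (drt (prog y₁) y₂ y₃)) y₁ v)
        (state x₁ x₂ x₃ (drt (prog y₁) v y₃))
  | set_pp_smi (x z z₁ z₂ y₁ y₂ y₃ v) :
      Estate
        (set_pp (state x (cpu tt z) (smram (prog z₁) (prog z₂)) (drt y₁ y₂ y₃)) (tup ![z₁, z₂]) v)
        (state x (cpu tt z) (smram (prog z₁) (prog z₂)) (drt y₁ v y₃))
  | set_lock_cpu (x₁ x₂ x₃ y₁ y₂ y₃ v) :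
      Estate (set_lock (state x₁ x₂ x₃ (drt y₁ y₂ y₃)) cpu_acc v)
        (state x₁ x₂ x₃ (drt y₁ y₂ v))
  | set_lock_pp (x₁ x₂ x₃ y₁ y₂ y₃ v) :
      Estate (set_lock (state x₁ x₂ x₃ (drt y₁ (prog y₂) y₃)) y₂ v)
        (state x₁ x₂ x₃ (drt y₁ (prog y₂) v))
  | set_lock_smi (x z z₁ z₂ y₁ y₂ y₃ v) :
      Estate
        (set_lock (state x (cpu tt z) (smram (prog z₁) (prog z₂)) (drt y₁ y₂ y₃))
          (tup ![z₁, z₂]) v)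
        (state x (cpu tt z) (smram (prog z₁) (prog z₂)) (drt y₁ y₂ v))

/-- `E_drt = E_data ∪ E_prog ∪ E_state`. -/
def Edrt : Theory := fun U V => Edata U V ∨ Eprog U V ∨ Estate U V

/-! ## The TPM process -/

def PCR_RESET : Proc :=
  .inp (V .ch) (.tup ![.test (K .reset_req), .bind .nonce, .bind .pfState]) <|
  .letIn .newSt (reset (V .pfState) tpm_acc (V .rv)) <|
  .out (V .ch) (tup ![K .reset_resp, V .nonce, V .newSt]) .nil

def TPM_RESET : Proc :=
  .par (.letIn .ch cpu_tpm <| .letIn .rv pd <| .repl PCR_RESET)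
    (.letIn .ch os <| .letIn .rv ps <| .repl PCR_RESET)

def PCR_EXTEND : Proc :=
  .inp (V .ch)
    (.tup ![.test (K .extend_req), .bind .nonce, .bind .pfState, .bind .val]) <|
  .letIn .newSt (extend (V .pfState) tpm_acc (V .val)) <|
  .out (V .ch) (tup ![K .extend_resp, V .nonce, V .newSt]) .nil

def TPM_EXTEND : Proc :=
  .par (.letIn .ch cpu_tpm <| .repl PCR_EXTEND) <|
  .par (.letIn .ch os <| .repl PCR_EXTEND) <|
  .repl (.inp cpu_tpm (.tup ![.test (K .ext_channel), .bind .ch]) <| .repl PCR_EXTEND)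

def UNSEAL : Proc :=
  .inp (V .ch) (.tup ![.test (K .tag_unsealing), .bind .blob]) <|
  .letIn .val (unsealData (V .blob) (pcr (V .pfState))) <|
  .out (V .ch) (tup ![K .tag_plain, V .val]) .nil

def TPM_UNSEAL : Proc :=
  .inp os (.bind .pfState) <|
  .ite (lock (V .pfState)) tt
    (.letIn .ch (tpm_ch (pp (V .pfState))) UNSEAL)
    (.letIn .ch os UNSEAL)

def TPM : Proc := .par (.repl TPM_RESET) <| .par (.repl TPM_EXTEND) (.repl TPM_UNSEAL)

/-! ## Launch and execution of a dynamic root of trust -/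

def CPU : Proc :=
  .repl <|
  .inp os (.tup ![.test (K .drt_req), .bind .init, .bind .pp, .bind .pfState]) <|
  .ite (lock (V .pfState)) ff
    (.letIn .s0' (set_int (V .pfState) cpu_acc ff) <|
     .letIn .s0 (set_lock (V .s0') cpu_acc tt) <|
     .letIn .measure (tup ![h (V .init), h (stm (V .pfState))]) <|
     .new .nonce <|
     .out cpu_tpm (tup ![K .reset_req, V .nonce, V .s0]) <|
     .inp cpu_tpm (.tup ![.test (K .reset_resp), .test (V .nonce), .bind .s1]) <|
     .out cpu_tpm (tup ![K .extend_req, V .nonce, V .s1, V .measure]) <|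
     .inp cpu_tpm (.tup ![.test (K .extend_resp), .test (V .nonce), .bind .s2]) <|
     .letIn .s3 (set_init (V .s2) cpu_acc (V .init)) <|
     .letIn .einit (get_entry (V .init)) <|
     .out (V .einit) (tup ![V .nonce, V .s3, tpm_ch (V .init), V .pp]) <|
     .out cpu_tpm (tup ![K .ext_channel, tpm_ch (V .init)]) <|
     .inp (V .einit) (.tup ![.test (K .drt_resp), .test (V .nonce), .bind .newState]) <|
     .letIn .epp (get_entry (pp (V .newState))) <|
     .out (V .epp) (tup ![V .newState, tpm_ch (prog (V .epp))]) <|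
     .out cpu_tpm (tup ![K .ext_channel, tpm_ch (prog (V .epp))]) .nil)
    .nil

/-- The trusted `INIT` program. -/
def INIT : Proc :=
  .out os (prog Tinit) <|
  .out os (prog Tstm) <|
  .inp Tinit (.tup ![.bind .nonce, .bind .pfSt, .bind .tpmc, .bind .pp]) <|
  .letIn .measure (h (V .pp)) <|
  .new .nonce1 <|
  .out (V .tpmc) (tup ![K .extend_req, V .nonce1, V .pfSt, V .measure]) <|
  .inp (V .tpmc) (.tup ![.test (K .extend_resp), .test (V .nonce1), .bind .extSt]) <|
  .letIn .newSt (set_pp (V .extSt) Tinit (V .pp)) <|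
  .out Tinit (tup ![K .drt_resp, V .nonce, V .newSt]) <|
  .out os (V .newSt) .nil

/-- The trusted protected program `PP`. -/
def PP : Proc :=
  .out os (prog Tpp) <|
  .inp Tpp (.tup ![.bind .pfState0, .bind .tpmc]) <|
  .letIn .pfSt (set_int (V .pfState0) Tpp tt) <|
  .out os (V .pfSt) <|
  .inp os (.bind .xSeal) <|
  .inp os (.bind .xEnc) <|
  .out (V .tpmc) (tup ![K .tag_unsealing, V .xSeal]) <|
  .inp (V .tpmc) (.tup ![.test (K .tag_plain), .bind .xK]) <|
  .letIn .mess (sdec (V .xEnc) (V .xK)) <|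
  .out os (V .mess) <|
  .new .rand <|
  .out (V .tpmc) (tup ![K .extend_req, V .rand, V .pfSt, bot]) <|
  .inp (V .tpmc) (.tup ![.test (K .extend_resp), .test (V .rand), .bind .exts]) <|
  .letIn .ends (set_lock (V .exts) Tpp ff) <|
  .out os (V .ends) .nil

/-- The expected `PCR` value: `p_d` extended with the measurements of the trusted `INIT` and
`STM`, and then of the trusted `PP`. -/
def hchain : Term :=
  h (tup ![h (tup ![pd, tup ![h (prog Tinit), h (prog Tstm)]]), h (prog Tpp)])

/-- `DATA` after the restriction of `k_pp`. -/
def DATA_body : Proc :=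
  .new .hipp <|
  .out os (senc (V .hipp) (V .kpp)) <|
  .letIn .sealedKey (sealData (V .kpp) hchain) <|
  .out os (V .sealedKey) .nil

def DATA : Proc := .new .kpp DATA_body

def SETUP : Proc :=
  .inp os (.bind .xStm) <|
  .inp os (.bind .xSmi) <|
  .out os (state (tpm ps) (cpu tt bot) (smram (V .xStm) (V .xSmi)) (drt bot bot ff)) <|
  .inp os (.bind .init) <|
  .inp os (.bind .pp) <|
  .inp os (.bind .pfState) <|
  .out os (tup ![K .drt_req, V .init, V .pp, V .pfState]) .nil

def EXEC : Proc :=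
  .par CPU <| .par (.repl INIT) <| .par SETUP <| .par DATA (.repl PP)

/-- The full process `DRT = TPM | EXEC`. -/
def DRTproc : Proc := .par TPM EXEC

/-! ## The security properties -/

/-- Code integrity, `Φ_int`. -/
def CodeIntegrity (E : Theory) (P : Proc) : Prop :=
  AttImpliesEq E P
    (state (tpm hchain) (cpu (V .xInt) (V .xCache)) (smram (V .xStm) (V .xSmi))
      (drt (V .xInit) (V .xPp) tt))
    (tup ![V .xInit, V .xPp, V .xStm])
    (tup ![prog Tinit, prog Tpp, prog Tstm])

/-- Secrecy of the sealed key, `Φ_sec`: `Att(k_pp) ⟹ false`. -/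
def KeySecrecy (E : Theory) (P : Proc) : Prop :=
  AttNewImpliesFalse E P .kpp DATA_body

end DRT

namespace DRT

/-! ## Arguments of compound terms -/

/-! The proof bounds the attacker's knowledge by an invariant that every step of every execution
preserves.

The heart of the matter is the chain of `PCR` values. `hchain` extends the trusted launch value
`launchPcr (prog Tinit) (prog Tstm)`, which extends `pd`, and `pd` is not a hash. Extension thus
reaches `hchain` only from the launch value, and that value only from `pd`. If no state known to the
attacker has `PCR` equal to `pd` or to the trusted launch value, no extension of such a state yields
`hchain`; this is `StateOk` with `StateOk.extend`. A reset to `pd` happens only on `cpu_tpm`, and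
the CPU sends a state with the trusted launch value only to `Tinit`. The trusted `INIT` releases
that state only after extending it with the measurement of the protected program, so `hchain`
appears only when the measured STM and protected program are the trusted ones, in a locked state.
Afterwards the attacker cannot change STM, `INIT`, `PP` or lock: the writers need a private access
constant, an unknown entry point, or an open lock (`Estate.known`). The trusted `PP` unlocks only
after extending with `bot`, which leaves `hchain`. This gives code integrity.

For secrecy, the key leaves `DATA` only as an encryption key and sealed to `hchain`. Unsealing with
`PCR` equal to `hchain` needs a state that is locked with `PP` trusted, so the answer goes to
`tpm_ch (prog Tpp)`, which the attacker does not know. `PP` uses the key only to decrypt a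
ciphertext received on a public channel, and the invariant says that plaintexts of known ciphertexts
are already known.

Formally, `Known` bounds the knowledge, `PrivMsg` lists the traffic on private channels, and a role
for each name records which state and measurement a nonce accompanies. `Safe` expresses that a
process respects these bounds. `Config.Ok.step` preserves them, `Proc.IsPublic.safe` covers every
attacker and `safe_DRTproc` the system. All is stated for the normal forms computed by `Term.nf`. -/

@[simp] theorem h_inj {a a' : Term} :
    h a = h a' ↔ a = a' :=
  ⟨fun e => by injection e with _ e; exact congrFun e 0, fun e => e ▸ rfl⟩

@[simp] theorem senc_inj {a b a' b' : Term} :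
    senc a b = senc a' b' ↔ a = a' ∧ b = b' :=
  ⟨fun e => by injection e with _ e; exact ⟨congrFun e 0, congrFun e 1⟩,
    by rintro ⟨rfl, rfl⟩; rfl⟩

@[simp] theorem sealData_inj {a b a' b' : Term} :
    sealData a b = sealData a' b' ↔ a = a' ∧ b = b' :=
  ⟨fun e => by injection e with _ e; exact ⟨congrFun e 0, congrFun e 1⟩,
    by rintro ⟨rfl, rfl⟩; rfl⟩

@[simp] theorem prog_inj {a a' : Term} :
    prog a = prog a' ↔ a = a' :=
  ⟨fun e => by injection e with _ e; exact congrFun e 0, fun e => e ▸ rfl⟩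

@[simp] theorem state_inj {a b c d a' b' c' d' : Term} :
    state a b c d = state a' b' c' d' ↔ a = a' ∧ b = b' ∧ c = c' ∧ d = d' :=
  ⟨fun e => by injection e with _ e; exact ⟨congrFun e 0, congrFun e 1, congrFun e 2, congrFun e 3⟩,
    by rintro ⟨rfl, rfl, rfl, rfl⟩; rfl⟩

@[simp] theorem tpm_inj {a a' : Term} :
    tpm a = tpm a' ↔ a = a' :=
  ⟨fun e => by injection e with _ e; exact congrFun e 0, fun e => e ▸ rfl⟩

@[simp] theorem cpu_inj {a b a' b' : Term} :
    cpu a b = cpu a' b' ↔ a = a' ∧ b = b' :=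
  ⟨fun e => by injection e with _ e; exact ⟨congrFun e 0, congrFun e 1⟩,
    by rintro ⟨rfl, rfl⟩; rfl⟩

@[simp] theorem smram_inj {a b a' b' : Term} :
    smram a b = smram a' b' ↔ a = a' ∧ b = b' :=
  ⟨fun e => by injection e with _ e; exact ⟨congrFun e 0, congrFun e 1⟩,
    by rintro ⟨rfl, rfl⟩; rfl⟩

@[simp] theorem drt_inj {a b c a' b' c' : Term} :
    drt a b c = drt a' b' c' ↔ a = a' ∧ b = b' ∧ c = c' :=
  ⟨fun e => by injection e with _ e; exact ⟨congrFun e 0, congrFun e 1, congrFun e 2⟩,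
    by rintro ⟨rfl, rfl, rfl⟩; rfl⟩

@[simp] theorem tpm_ch_inj {a a' : Term} :
    tpm_ch a = tpm_ch a' ↔ a = a' :=
  ⟨fun e => by injection e with _ e; exact congrFun e 0, fun e => e ▸ rfl⟩

@[simp] theorem sdec_inj {a b a' b' : Term} :
    sdec a b = sdec a' b' ↔ a = a' ∧ b = b' :=
  ⟨fun e => by injection e with _ e; exact ⟨congrFun e 0, congrFun e 1⟩,
    by rintro ⟨rfl, rfl⟩; rfl⟩

@[simp] theorem unsealData_inj {a b a' b' : Term} :
    unsealData a b = unsealData a' b' ↔ a = a' ∧ b = b' :=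
  ⟨fun e => by injection e with _ e; exact ⟨congrFun e 0, congrFun e 1⟩,
    by rintro ⟨rfl, rfl⟩; rfl⟩

@[simp] theorem get_entry_inj {a a' : Term} :
    get_entry a = get_entry a' ↔ a = a' :=
  ⟨fun e => by injection e with _ e; exact congrFun e 0, fun e => e ▸ rfl⟩

@[simp] theorem pcr_inj {a a' : Term} :
    pcr a = pcr a' ↔ a = a' :=
  ⟨fun e => by injection e with _ e; exact congrFun e 0, fun e => e ▸ rfl⟩

@[simp] theorem pp_inj {a a' : Term} :
    pp a = pp a' ↔ a = a' :=
  ⟨fun e => by injection e with _ e; exact congrFun e 0, fun e => e ▸ rfl⟩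

@[simp] theorem lock_inj {a a' : Term} :
    lock a = lock a' ↔ a = a' :=
  ⟨fun e => by injection e with _ e; exact congrFun e 0, fun e => e ▸ rfl⟩

@[simp] theorem reset_inj {a b c a' b' c' : Term} :
    reset a b c = reset a' b' c' ↔ a = a' ∧ b = b' ∧ c = c' :=
  ⟨fun e => by injection e with _ e; exact ⟨congrFun e 0, congrFun e 1, congrFun e 2⟩,
    by rintro ⟨rfl, rfl, rfl⟩; rfl⟩

@[simp] theorem extend_inj {a b c a' b' c' : Term} :
    extend a b c = extend a' b' c' ↔ a = a' ∧ b = b' ∧ c = c' :=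
  ⟨fun e => by injection e with _ e; exact ⟨congrFun e 0, congrFun e 1, congrFun e 2⟩,
    by rintro ⟨rfl, rfl, rfl⟩; rfl⟩

@[simp] theorem set_int_inj {a b c a' b' c' : Term} :
    set_int a b c = set_int a' b' c' ↔ a = a' ∧ b = b' ∧ c = c' :=
  ⟨fun e => by injection e with _ e; exact ⟨congrFun e 0, congrFun e 1, congrFun e 2⟩,
    by rintro ⟨rfl, rfl, rfl⟩; rfl⟩

@[simp] theorem set_lock_inj {a b c a' b' c' : Term} :
    set_lock a b c = set_lock a' b' c' ↔ a = a' ∧ b = b' ∧ c = c' :=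
  ⟨fun e => by injection e with _ e; exact ⟨congrFun e 0, congrFun e 1, congrFun e 2⟩,
    by rintro ⟨rfl, rfl, rfl⟩; rfl⟩

@[simp] theorem tup2_inj {a b a' b' : Term} :
    tup ![a, b] = tup ![a', b'] ↔ a = a' ∧ b = b' :=
  ⟨fun e => by injection e with _ e; exact ⟨congrFun e 0, congrFun e 1⟩,
    by rintro ⟨rfl, rfl⟩; rfl⟩

@[simp] theorem tup3_inj {a b c a' b' c' : Term} :
    tup ![a, b, c] = tup ![a', b', c'] ↔ a = a' ∧ b = b' ∧ c = c' :=
  ⟨fun e => by injection e with _ e; exact ⟨congrFun e 0, congrFun e 1, congrFun e 2⟩,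
    by rintro ⟨rfl, rfl, rfl⟩; rfl⟩

@[simp] theorem tup4_inj {a b c d a' b' c' d' : Term} :
    tup ![a, b, c, d] = tup ![a', b', c', d'] ↔ a = a' ∧ b = b' ∧ c = c' ∧ d = d' :=
  ⟨fun e => by injection e with _ e; exact ⟨congrFun e 0, congrFun e 1, congrFun e 2, congrFun e 3⟩,
    by rintro ⟨rfl, rfl, rfl, rfl⟩; rfl⟩

/-! ## Substitution -/

@[simp] theorem subst_var (σ : Subst) (x : Var) : (V x).subst σ = σ x := rfl

theorem subst_const (σ : Subst) (f : Sym) (hf : f.arity = 0) : (K f hf).subst σ = K f hf :=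
  congrArg (Term.app f) (funext fun i => absurd i.isLt (by omega))

@[simp] theorem subst_consts (σ : Subst) :
    os.subst σ = os ∧ cpu_tpm.subst σ = cpu_tpm ∧ tpm_acc.subst σ = tpm_acc ∧
    cpu_acc.subst σ = cpu_acc ∧ ps.subst σ = ps ∧ pd.subst σ = pd ∧ tt.subst σ = tt ∧
    ff.subst σ = ff ∧ bot.subst σ = bot ∧ Tinit.subst σ = Tinit ∧ Tpp.subst σ = Tpp ∧
    Tstm.subst σ = Tstm ∧ (K .reset_req).subst σ = K .reset_req ∧
    (K .reset_resp).subst σ = K .reset_resp ∧ (K .extend_req).subst σ = K .extend_req ∧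
    (K .extend_resp).subst σ = K .extend_resp ∧ (K .ext_channel).subst σ = K .ext_channel ∧
    (K .tag_unsealing).subst σ = K .tag_unsealing ∧ (K .tag_plain).subst σ = K .tag_plain ∧
    (K .drt_req).subst σ = K .drt_req ∧ (K .drt_resp).subst σ = K .drt_resp := by
  refine ⟨?_, ?_, ?_, ?_, ?_, ?_, ?_, ?_, ?_, ?_, ?_, ?_, ?_, ?_, ?_, ?_, ?_, ?_, ?_, ?_, ?_⟩ <;>
    exact subst_const σ _ _

@[simp] theorem subst_h (σ : Subst) (a : Term) :
    (h a).subst σ = h (a.subst σ) :=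
  congrArg (Term.app .h) (funext fun i => by fin_cases i; rfl)

@[simp] theorem subst_senc (σ : Subst) (a b : Term) :
    (senc a b).subst σ = senc (a.subst σ) (b.subst σ) :=
  congrArg (Term.app .senc) (funext fun i => by fin_cases i <;> rfl)

@[simp] theorem subst_sealData (σ : Subst) (a b : Term) :
    (sealData a b).subst σ = sealData (a.subst σ) (b.subst σ) :=
  congrArg (Term.app .sealData) (funext fun i => by fin_cases i <;> rfl)

@[simp] theorem subst_prog (σ : Subst) (a : Term) :
    (prog a).subst σ = prog (a.subst σ) :=
  congrArg (Term.app .prog) (funext fun i => by fin_cases i; rfl)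

@[simp] theorem subst_state (σ : Subst) (a b c d : Term) :
    (state a b c d).subst σ = state (a.subst σ) (b.subst σ) (c.subst σ) (d.subst σ) :=
  congrArg (Term.app .state) (funext fun i => by fin_cases i <;> rfl)

@[simp] theorem subst_tpm (σ : Subst) (a : Term) :
    (tpm a).subst σ = tpm (a.subst σ) :=
  congrArg (Term.app .tpm) (funext fun i => by fin_cases i; rfl)

@[simp] theorem subst_cpu (σ : Subst) (a b : Term) :
    (cpu a b).subst σ = cpu (a.subst σ) (b.subst σ) :=
  congrArg (Term.app .cpu) (funext fun i => by fin_cases i <;> rfl)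

@[simp] theorem subst_smram (σ : Subst) (a b : Term) :
    (smram a b).subst σ = smram (a.subst σ) (b.subst σ) :=
  congrArg (Term.app .smram) (funext fun i => by fin_cases i <;> rfl)

@[simp] theorem subst_drt (σ : Subst) (a b c : Term) :
    (drt a b c).subst σ = drt (a.subst σ) (b.subst σ) (c.subst σ) :=
  congrArg (Term.app .drt) (funext fun i => by fin_cases i <;> rfl)

@[simp] theorem subst_tpm_ch (σ : Subst) (a : Term) :
    (tpm_ch a).subst σ = tpm_ch (a.subst σ) :=
  congrArg (Term.app .tpm_ch) (funext fun i => by fin_cases i; rfl)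

@[simp] theorem subst_reset (σ : Subst) (a b c : Term) :
    (reset a b c).subst σ = reset (a.subst σ) (b.subst σ) (c.subst σ) :=
  congrArg (Term.app .reset) (funext fun i => by fin_cases i <;> rfl)

@[simp] theorem subst_extend (σ : Subst) (a b c : Term) :
    (extend a b c).subst σ = extend (a.subst σ) (b.subst σ) (c.subst σ) :=
  congrArg (Term.app .extend) (funext fun i => by fin_cases i <;> rfl)

@[simp] theorem subst_set_int (σ : Subst) (a b c : Term) :
    (set_int a b c).subst σ = set_int (a.subst σ) (b.subst σ) (c.subst σ) :=
  congrArg (Term.app .set_int) (funext fun i => by fin_cases i <;> rfl)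

@[simp] theorem subst_set_lock (σ : Subst) (a b c : Term) :
    (set_lock a b c).subst σ = set_lock (a.subst σ) (b.subst σ) (c.subst σ) :=
  congrArg (Term.app .set_lock) (funext fun i => by fin_cases i <;> rfl)

@[simp] theorem subst_set_init (σ : Subst) (a b c : Term) :
    (set_init a b c).subst σ = set_init (a.subst σ) (b.subst σ) (c.subst σ) :=
  congrArg (Term.app .set_init) (funext fun i => by fin_cases i <;> rfl)

@[simp] theorem subst_set_pp (σ : Subst) (a b c : Term) :
    (set_pp a b c).subst σ = set_pp (a.subst σ) (b.subst σ) (c.subst σ) :=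
  congrArg (Term.app .set_pp) (funext fun i => by fin_cases i <;> rfl)

@[simp] theorem subst_get_entry (σ : Subst) (a : Term) :
    (get_entry a).subst σ = get_entry (a.subst σ) :=
  congrArg (Term.app .get_entry) (funext fun i => by fin_cases i; rfl)

@[simp] theorem subst_pp (σ : Subst) (a : Term) :
    (pp a).subst σ = pp (a.subst σ) :=
  congrArg (Term.app .pp) (funext fun i => by fin_cases i; rfl)

@[simp] theorem subst_stm (σ : Subst) (a : Term) :
    (stm a).subst σ = stm (a.subst σ) :=
  congrArg (Term.app .stm) (funext fun i => by fin_cases i; rfl)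

@[simp] theorem subst_lock (σ : Subst) (a : Term) :
    (lock a).subst σ = lock (a.subst σ) :=
  congrArg (Term.app .lock) (funext fun i => by fin_cases i; rfl)

@[simp] theorem subst_pcr (σ : Subst) (a : Term) :
    (pcr a).subst σ = pcr (a.subst σ) :=
  congrArg (Term.app .pcr) (funext fun i => by fin_cases i; rfl)

@[simp] theorem subst_unsealData (σ : Subst) (a b : Term) :
    (unsealData a b).subst σ = unsealData (a.subst σ) (b.subst σ) :=
  congrArg (Term.app .unsealData) (funext fun i => by fin_cases i <;> rfl)

@[simp] theorem subst_sdec (σ : Subst) (a b : Term) :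
    (sdec a b).subst σ = sdec (a.subst σ) (b.subst σ) :=
  congrArg (Term.app .sdec) (funext fun i => by fin_cases i <;> rfl)

@[simp] theorem subst_tup2 (σ : Subst) (a b : Term) :
    (tup ![a, b]).subst σ = tup ![a.subst σ, b.subst σ] :=
  congrArg (Term.app (.tup 2)) (funext fun i => by fin_cases i <;> rfl)

@[simp] theorem subst_tup3 (σ : Subst) (a b c : Term) :
    (tup ![a, b, c]).subst σ = tup ![a.subst σ, b.subst σ, c.subst σ] :=
  congrArg (Term.app (.tup 3)) (funext fun i => by fin_cases i <;> rfl)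

@[simp] theorem subst_tup4 (σ : Subst) (a b c d : Term) :
    (tup ![a, b, c, d]).subst σ = tup ![a.subst σ, b.subst σ, c.subst σ, d.subst σ] :=
  congrArg (Term.app (.tup 4)) (funext fun i => by fin_cases i <;> rfl)

@[simp] theorem subst_hchain (σ : Subst) : hchain.subst σ = hchain := by simp [hchain]

/-! ## Normalization -/

namespace Term

def head : Term → Sym
  | .app f _ => f
  | _ => .bot

/-- The default value is harmless: `contractum` is used only on redexes, where every position that
enters the result exists. -/
def arg : Term → ℕ → Term
  | .app f ts, i => if hi : i < f.arity then ts ⟨i, hi⟩ else .app f ts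
  | T, _ => T

/-- The right-hand side of the rule that applies at the root of a redex. -/
def contractum (U : Term) : Term :=
  let S := U.arg 0
  let v := U.arg 2
  match U.head with
  | .sdec | .unsealData | .get_entry => S.arg 0
  | .pcr => (S.arg 0).arg 0
  | .int => (S.arg 1).arg 0
  | .cache => (S.arg 1).arg 1
  | .stm => (S.arg 2).arg 0
  | .smi => (S.arg 2).arg 1
  | .init => (S.arg 3).arg 0
  | .pp => (S.arg 3).arg 1
  | .lock => (S.arg 3).arg 2
  | .reset | .set_pcr => state (tpm v) (S.arg 1) (S.arg 2) (S.arg 3)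
  | .extend => state (tpm (DRT.h (tup ![(S.arg 0).arg 0, v]))) (S.arg 1) (S.arg 2) (S.arg 3)
  | .set_int => state (S.arg 0) (cpu v ((S.arg 1).arg 1)) (S.arg 2) (S.arg 3)
  | .set_cache => state (S.arg 0) (cpu ((S.arg 1).arg 0) (U.arg 1)) (S.arg 2) (S.arg 3)
  | .flush_stm => state (S.arg 0) (S.arg 1) (smram ((S.arg 1).arg 1) ((S.arg 2).arg 1)) (S.arg 3)
  | .flush_smi => state (S.arg 0) (S.arg 1) (smram ((S.arg 2).arg 0) ((S.arg 1).arg 1)) (S.arg 3)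
  | .set_init => state (S.arg 0) (S.arg 1) (S.arg 2) (drt v ((S.arg 3).arg 1) ((S.arg 3).arg 2))
  | .set_pp => state (S.arg 0) (S.arg 1) (S.arg 2) (drt ((S.arg 3).arg 0) v ((S.arg 3).arg 2))
  | .set_lock => state (S.arg 0) (S.arg 1) (S.arg 2) (drt ((S.arg 3).arg 0) ((S.arg 3).arg 1) v)
  | _ => U

end Term

/-- Rules for the same symbol differ in their side conditions but overwrite the same component, so
the result is a function of the redex. Root steps are therefore deterministic in spite of
overlapping rules. -/
theorem Edrt.contractum_eq {U W : Term} (hE : Edrt U W) : U.contractum = W := by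
  rcases hE with hE | hE | hE <;> cases hE <;> rfl

open Classical in
/-- Contraction at the root, where a rule applies. -/
noncomputable def Term.contract (U : Term) : Term :=
  if ∃ W, Edrt U W then U.contractum else U

theorem Edrt.contract_eq {U W : Term} (hE : Edrt U W) : U.contract = W := by
  rw [Term.contract, if_pos ⟨W, hE⟩, hE.contractum_eq]

theorem Term.contract_cases (U : Term) : Edrt U U.contract ∨ U.contract = U := by
  by_cases hU : ∃ W, Edrt U W
  · obtain ⟨W, hW⟩ := hU
    exact .inl (hW.contract_eq ▸ hW)
  · exact .inr (if_neg hU)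

/-- Innermost normalization. -/
noncomputable def Term.nf : Term → Term
  | .var x => .var x
  | .name n => .name n
  | .app f ts => (Term.app f fun i => (ts i).nf).contract

@[simp] theorem nf_var (x : Var) : (Term.var x).nf = .var x := rfl

@[simp] theorem nf_name (n : ℕ) : (Term.name n).nf = .name n := rfl

def Sym.Destructor : Sym → Prop
  | .sdec | .unsealData | .get_entry => True
  | .pcr | .int | .cache | .stm | .smi | .init | .pp | .lock => True
  | .reset | .extend | .set_pcr | .set_int | .set_cache | .flush_stm | .flush_smi => True
  | .set_init | .set_pp | .set_lock => True
  | _ => False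

theorem Edrt.destructor {f : Sym} {ts : Fin f.arity → Term} {W : Term}
    (hE : Edrt (.app f ts) W) : f.Destructor := by
  suffices hh : ∀ U, Edrt U W → U.head.Destructor from hh _ hE
  intro U hU
  rcases hU with hU | hU | hU <;> cases hU <;> trivial

theorem isDestructor_iff (f : Sym) : IsDestructor Edrt f ↔ f.Destructor := by
  refine ⟨fun ⟨_, _, hE⟩ => hE.destructor, fun hf => ?_⟩
  cases f <;> first | exact hf.elim | skip
  -- One rule instance per destructor; the filling by `bot` is arbitrary.
  exacts [⟨_, _, .inl (.sdec bot bot)⟩, ⟨_, _, .inl (.unsealData bot bot)⟩,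
    ⟨_, _, .inr (.inl (.get_entry bot))⟩, ⟨_, _, .inr (.inr (.pcr bot bot bot bot))⟩,
    ⟨_, _, .inr (.inr (.int bot bot bot bot bot))⟩,
    ⟨_, _, .inr (.inr (.cache bot bot bot bot bot))⟩,
    ⟨_, _, .inr (.inr (.stm bot bot bot bot bot))⟩,
    ⟨_, _, .inr (.inr (.smi bot bot bot bot bot))⟩,
    ⟨_, _, .inr (.inr (.init bot bot bot bot bot bot))⟩,
    ⟨_, _, .inr (.inr (.pp bot bot bot bot bot bot))⟩,
    ⟨_, _, .inr (.inr (.lock bot bot bot bot bot bot))⟩,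
    ⟨_, _, .inr (.inr (.reset_ps bot bot bot bot))⟩,
    ⟨_, _, .inr (.inr (.extend bot bot bot bot bot))⟩,
    ⟨_, _, .inr (.inr (.set_pcr bot bot bot bot bot))⟩,
    ⟨_, _, .inr (.inr (.set_int_cpu bot bot bot bot bot bot))⟩,
    ⟨_, _, .inr (.inr (.set_cache bot bot bot bot bot bot))⟩,
    ⟨_, _, .inr (.inr (.flush_stm bot bot bot bot bot bot bot))⟩,
    ⟨_, _, .inr (.inr (.flush_smi bot bot bot bot bot bot))⟩,
    ⟨_, _, .inr (.inr (.set_init bot bot bot bot bot bot bot))⟩,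
    ⟨_, _, .inr (.inr (.set_pp_cpu bot bot bot bot bot bot bot))⟩,
    ⟨_, _, .inr (.inr (.set_lock_cpu bot bot bot bot bot bot bot))⟩]

theorem nf_app_of_not_destructor {f : Sym} (hf : ¬ f.Destructor) (ts : Fin f.arity → Term) :
    (Term.app f ts).nf = .app f fun i => (ts i).nf :=
  if_neg fun ⟨_, hE⟩ => hf hE.destructor

theorem nf_const (f : Sym) (hf : f.arity = 0) : (K f hf).nf = K f hf := by
  have hd : ¬ f.Destructor := by
    cases f <;> first | exact id | (exact absurd hf (by decide))
  rw [nf_app_of_not_destructor hd]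
  exact congrArg (Term.app f) (funext fun i => absurd i.isLt (by omega))

@[simp] theorem nf_consts :
    os.nf = os ∧ cpu_tpm.nf = cpu_tpm ∧ tpm_acc.nf = tpm_acc ∧ cpu_acc.nf = cpu_acc ∧
    ps.nf = ps ∧ pd.nf = pd ∧ tt.nf = tt ∧ ff.nf = ff ∧ bot.nf = bot ∧ Tinit.nf = Tinit ∧
    Tpp.nf = Tpp ∧ Tstm.nf = Tstm ∧ (K .reset_req).nf = K .reset_req ∧
    (K .reset_resp).nf = K .reset_resp ∧ (K .extend_req).nf = K .extend_req ∧
    (K .extend_resp).nf = K .extend_resp ∧ (K .ext_channel).nf = K .ext_channel ∧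
    (K .tag_unsealing).nf = K .tag_unsealing ∧ (K .tag_plain).nf = K .tag_plain ∧
    (K .drt_req).nf = K .drt_req ∧ (K .drt_resp).nf = K .drt_resp := by
  refine ⟨?_, ?_, ?_, ?_, ?_, ?_, ?_, ?_, ?_, ?_, ?_, ?_, ?_, ?_, ?_, ?_, ?_, ?_, ?_, ?_, ?_⟩ <;>
    exact nf_const _ _

@[simp] theorem nf_h (a : Term) :
    (h a).nf = h a.nf :=
  (nf_app_of_not_destructor id _).trans
    (congrArg (Term.app .h) (funext fun i => by fin_cases i; rfl))

@[simp] theorem nf_senc (a b : Term) :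
    (senc a b).nf = senc a.nf b.nf :=
  (nf_app_of_not_destructor id _).trans
    (congrArg (Term.app .senc) (funext fun i => by fin_cases i <;> rfl))

@[simp] theorem nf_sealData (a b : Term) :
    (sealData a b).nf = sealData a.nf b.nf :=
  (nf_app_of_not_destructor id _).trans
    (congrArg (Term.app .sealData) (funext fun i => by fin_cases i <;> rfl))

@[simp] theorem nf_prog (a : Term) :
    (prog a).nf = prog a.nf :=
  (nf_app_of_not_destructor id _).trans
    (congrArg (Term.app .prog) (funext fun i => by fin_cases i; rfl))

@[simp] theorem nf_state (a b c d : Term) :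
    (state a b c d).nf = state a.nf b.nf c.nf d.nf :=
  (nf_app_of_not_destructor id _).trans
    (congrArg (Term.app .state) (funext fun i => by fin_cases i <;> rfl))

@[simp] theorem nf_tpm (a : Term) :
    (tpm a).nf = tpm a.nf :=
  (nf_app_of_not_destructor id _).trans
    (congrArg (Term.app .tpm) (funext fun i => by fin_cases i; rfl))

@[simp] theorem nf_cpu (a b : Term) :
    (cpu a b).nf = cpu a.nf b.nf :=
  (nf_app_of_not_destructor id _).trans
    (congrArg (Term.app .cpu) (funext fun i => by fin_cases i <;> rfl))

@[simp] theorem nf_smram (a b : Term) :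
    (smram a b).nf = smram a.nf b.nf :=
  (nf_app_of_not_destructor id _).trans
    (congrArg (Term.app .smram) (funext fun i => by fin_cases i <;> rfl))

@[simp] theorem nf_drt (a b c : Term) :
    (drt a b c).nf = drt a.nf b.nf c.nf :=
  (nf_app_of_not_destructor id _).trans
    (congrArg (Term.app .drt) (funext fun i => by fin_cases i <;> rfl))

@[simp] theorem nf_tpm_ch (a : Term) :
    (tpm_ch a).nf = tpm_ch a.nf :=
  (nf_app_of_not_destructor id _).trans
    (congrArg (Term.app .tpm_ch) (funext fun i => by fin_cases i; rfl))

@[simp] theorem nf_tup2 (a b : Term) :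
    (tup ![a, b]).nf = tup ![a.nf, b.nf] :=
  (nf_app_of_not_destructor id _).trans
    (congrArg (Term.app (.tup 2)) (funext fun i => by fin_cases i <;> rfl))

@[simp] theorem nf_tup3 (a b c : Term) :
    (tup ![a, b, c]).nf = tup ![a.nf, b.nf, c.nf] :=
  (nf_app_of_not_destructor id _).trans
    (congrArg (Term.app (.tup 3)) (funext fun i => by fin_cases i <;> rfl))

@[simp] theorem nf_tup4 (a b c d : Term) :
    (tup ![a, b, c, d]).nf = tup ![a.nf, b.nf, c.nf, d.nf] :=
  (nf_app_of_not_destructor id _).trans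
    (congrArg (Term.app (.tup 4)) (funext fun i => by fin_cases i <;> rfl))

theorem nf_sdec (a b : Term) :
    (sdec a b).nf = (sdec a.nf b.nf).contract :=
  congrArg (fun ts => (Term.app .sdec ts).contract) (funext fun i => by fin_cases i <;> rfl)

theorem nf_unsealData (a b : Term) :
    (unsealData a b).nf = (unsealData a.nf b.nf).contract :=
  congrArg (fun ts => (Term.app .unsealData ts).contract) (funext fun i => by fin_cases i <;> rfl)

theorem nf_get_entry (a : Term) :
    (get_entry a).nf = (get_entry a.nf).contract :=
  congrArg (fun ts => (Term.app .get_entry ts).contract) (funext fun i => by fin_cases i; rfl)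

theorem nf_pcr (a : Term) :
    (pcr a).nf = (pcr a.nf).contract :=
  congrArg (fun ts => (Term.app .pcr ts).contract) (funext fun i => by fin_cases i; rfl)

theorem nf_int (a : Term) :
    (int a).nf = (int a.nf).contract :=
  congrArg (fun ts => (Term.app .int ts).contract) (funext fun i => by fin_cases i; rfl)

theorem nf_cache (a : Term) :
    (cache a).nf = (cache a.nf).contract :=
  congrArg (fun ts => (Term.app .cache ts).contract) (funext fun i => by fin_cases i; rfl)

theorem nf_stm (a : Term) :
    (stm a).nf = (stm a.nf).contract :=
  congrArg (fun ts => (Term.app .stm ts).contract) (funext fun i => by fin_cases i; rfl)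

theorem nf_smi (a : Term) :
    (smi a).nf = (smi a.nf).contract :=
  congrArg (fun ts => (Term.app .smi ts).contract) (funext fun i => by fin_cases i; rfl)

theorem nf_init (a : Term) :
    (init a).nf = (init a.nf).contract :=
  congrArg (fun ts => (Term.app .init ts).contract) (funext fun i => by fin_cases i; rfl)

theorem nf_pp (a : Term) :
    (pp a).nf = (pp a.nf).contract :=
  congrArg (fun ts => (Term.app .pp ts).contract) (funext fun i => by fin_cases i; rfl)

theorem nf_lock (a : Term) :
    (lock a).nf = (lock a.nf).contract :=
  congrArg (fun ts => (Term.app .lock ts).contract) (funext fun i => by fin_cases i; rfl)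

theorem nf_reset (a b c : Term) :
    (reset a b c).nf = (reset a.nf b.nf c.nf).contract :=
  congrArg (fun ts => (Term.app .reset ts).contract) (funext fun i => by fin_cases i <;> rfl)

theorem nf_extend (a b c : Term) :
    (extend a b c).nf = (extend a.nf b.nf c.nf).contract :=
  congrArg (fun ts => (Term.app .extend ts).contract) (funext fun i => by fin_cases i <;> rfl)

theorem nf_set_pcr (a b c : Term) :
    (set_pcr a b c).nf = (set_pcr a.nf b.nf c.nf).contract :=
  congrArg (fun ts => (Term.app .set_pcr ts).contract) (funext fun i => by fin_cases i <;> rfl)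

theorem nf_set_int (a b c : Term) :
    (set_int a b c).nf = (set_int a.nf b.nf c.nf).contract :=
  congrArg (fun ts => (Term.app .set_int ts).contract) (funext fun i => by fin_cases i <;> rfl)

theorem nf_set_cache (a b : Term) :
    (set_cache a b).nf = (set_cache a.nf b.nf).contract :=
  congrArg (fun ts => (Term.app .set_cache ts).contract) (funext fun i => by fin_cases i <;> rfl)

theorem nf_flush_stm (a : Term) :
    (flush_stm a).nf = (flush_stm a.nf).contract :=
  congrArg (fun ts => (Term.app .flush_stm ts).contract) (funext fun i => by fin_cases i; rfl)

theorem nf_flush_smi (a : Term) :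
    (flush_smi a).nf = (flush_smi a.nf).contract :=
  congrArg (fun ts => (Term.app .flush_smi ts).contract) (funext fun i => by fin_cases i; rfl)

theorem nf_set_init (a b c : Term) :
    (set_init a b c).nf = (set_init a.nf b.nf c.nf).contract :=
  congrArg (fun ts => (Term.app .set_init ts).contract) (funext fun i => by fin_cases i <;> rfl)

theorem nf_set_pp (a b c : Term) :
    (set_pp a b c).nf = (set_pp a.nf b.nf c.nf).contract :=
  congrArg (fun ts => (Term.app .set_pp ts).contract) (funext fun i => by fin_cases i <;> rfl)

theorem nf_set_lock (a b c : Term) :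
    (set_lock a b c).nf = (set_lock a.nf b.nf c.nf).contract :=
  congrArg (fun ts => (Term.app .set_lock ts).contract) (funext fun i => by fin_cases i <;> rfl)

@[simp] theorem nf_hchain : hchain.nf = hchain := by simp [hchain]

/-! ### Invariance of `nf` under rewriting. -/

theorem Edata.nf_eq {U W : Term} (hE : Edata U W) : U.nf = W.nf := by
  cases hE
  case sdec => simpa only [nf_sdec, nf_senc] using Edrt.contract_eq (.inl (.sdec ..))
  case unsealData =>
    simpa only [nf_unsealData, nf_sealData] using Edrt.contract_eq (.inl (.unsealData ..))

theorem Eprog.nf_eq {U W : Term} (hE : Eprog U W) : U.nf = W.nf := by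
  cases hE
  simpa only [nf_get_entry, nf_prog] using Edrt.contract_eq (.inr (.inl (.get_entry ..)))

theorem Estate.nf_eq {U W : Term} (hE : Estate U W) : U.nf = W.nf := by
  cases hE <;>
    simp only [nf_h, nf_prog, nf_state, nf_tpm, nf_cpu, nf_smram, nf_drt, nf_pcr, nf_int, nf_cache,
      nf_stm, nf_smi, nf_init, nf_pp, nf_lock, nf_reset, nf_extend, nf_set_pcr, nf_set_int,
      nf_set_cache, nf_flush_stm, nf_flush_smi, nf_set_init, nf_set_pp, nf_set_lock, nf_tup2,
      nf_consts] <;>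
    refine Edrt.contract_eq (.inr (.inr ?_))
  exacts [.pcr .., .int .., .cache .., .stm .., .smi .., .init .., .pp ..,
    .lock .., .reset_ps .., .reset_pd .., .extend .., .set_pcr ..,
    .set_int_cpu .., .set_int_pp .., .set_cache .., .flush_stm ..,
    .flush_smi .., .set_init .., .set_pp_cpu .., .set_pp_init ..,
    .set_pp_smi .., .set_lock_cpu .., .set_lock_pp .., .set_lock_smi ..]

/-- Below the root, left-hand sides contain only constructors, so normalizing the arguments gives
another instance of the same rule. Right-hand sides contain no destructors either, so the contractum
of that instance is the normal form of `W`. -/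
theorem Edrt.nf_eq {U W : Term} (hE : Edrt U W) : U.nf = W.nf := by
  rcases hE with hE | hE | hE
  exacts [hE.nf_eq, hE.nf_eq, hE.nf_eq]

theorem Rew.nf_eq {U W : Term} (hR : Rew Edrt U W) : U.nf = W.nf := by
  induction hR with
  | root hE => exact hE.nf_eq
  | arg f ts i _ ih =>
    refine congrArg (fun us => (Term.app f us).contract) (funext fun j => ?_)
    by_cases hj : j = i
    · subst hj; simpa using ih
    · simp [hj]

theorem reflTransGen_nf_eq {U W : Term} (hR : Relation.ReflTransGen (Rew Edrt) U W) :
    U.nf = W.nf := by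
  induction hR with
  | refl => rfl
  | tail _ hR ih => exact ih.trans hR.nf_eq

theorem reflTransGen_arg (f : Sym) (ts : Fin f.arity → Term) (i : Fin f.arity) {U : Term}
    (hR : Relation.ReflTransGen (Rew Edrt) (ts i) U) :
    Relation.ReflTransGen (Rew Edrt) (.app f ts) (.app f (Function.update ts i U)) := by
  induction hR with
  | refl => simpa using Relation.ReflTransGen.refl
  | tail _ hR ih =>
    refine ih.tail ?_
    simpa using Rew.arg f (Function.update ts i _) i (by simpa using hR)

theorem reflTransGen_args (f : Sym) (ts us : Fin f.arity → Term)
    (hR : ∀ i, Relation.ReflTransGen (Rew Edrt) (ts i) (us i)) :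
    Relation.ReflTransGen (Rew Edrt) (.app f ts) (.app f us) := by
  -- The arguments are rewritten one at a time; `s` is the set of positions already treated.
  suffices hh : ∀ s : Finset (Fin f.arity), Relation.ReflTransGen (Rew Edrt) (.app f ts)
      (.app f fun i => if i ∈ s then us i else ts i) by simpa using hh Finset.univ
  intro s
  induction s using Finset.induction_on with
  | empty => simpa using Relation.ReflTransGen.refl
  | insert a s ha ih =>
    refine ih.trans ?_
    have := reflTransGen_arg f (fun i => if i ∈ s then us i else ts i) a (U := us a)
      (by simpa [ha] using hR a)
    convert this using 2
    funext i
    by_cases hi : i = a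
    · subst hi; simp
    · simp [hi]

theorem reflTransGen_nf (T : Term) : Relation.ReflTransGen (Rew Edrt) T T.nf := by
  induction T with
  | var x => exact .refl
  | name n => exact .refl
  | app f ts ih =>
    refine (reflTransGen_args f ts _ ih).trans ?_
    rcases Term.contract_cases (.app f fun i => (ts i).nf) with hE | hE
    · exact .single (.root hE)
    · exact hE.symm ▸ .refl

theorem Irred.nf_eq {T : Term} (hT : Irred Edrt T) : T.nf = T := by
  rcases (reflTransGen_nf T).cases_head with hh | ⟨U, hU, -⟩
  · exact hh.symm
  · exact (hT U hU).elim

theorem IsNormalForm.nf_eq {T U : Term} (hT : IsNormalForm Edrt T U) : T.nf = U :=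
  (reflTransGen_nf_eq hT.1).trans hT.2.nf_eq

theorem EqE.nf_eq {T U : Term} (hE : EqE Edrt T U) : T.nf = U.nf := by
  obtain ⟨W, hT, hU⟩ := hE
  exact hT.nf_eq.trans hU.nf_eq.symm

theorem NoDestructor.irred {T : Term} (hT : NoDestructor Edrt T) : Irred Edrt T := by
  induction T with
  | var x => rintro U (hU | _); rcases hU with hU | hU | hU <;> cases hU
  | name n => rintro U (hU | _); rcases hU with hU | hU | hU <;> cases hU
  | app f ts ih =>
    intro U hU
    generalize hW : Term.app f ts = W at hU
    cases hU with
    | root hE => exact hT.1 ⟨ts, U, hW ▸ hE⟩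
    | arg g us i hR =>
      cases hW
      exact ih i (hT.2 i) _ hR

theorem noDestructor_const {f : Sym} (hf : f.arity = 0) : NoDestructor Edrt (K f hf) := by
  refine ⟨fun hd => ?_, fun i => absurd i.isLt (by omega)⟩
  rw [isDestructor_iff] at hd
  cases f <;> first | exact hd | (exact absurd hf (by decide))

/-- Absence of destructors supplies the irreducibility that `EqE` demands of the common normal form.
-/
theorem EqE.of_nf_eq {T U : Term} (hN : NoDestructor Edrt T.nf) (hE : T.nf = U.nf) :
    EqE Edrt T U :=
  ⟨T.nf, ⟨reflTransGen_nf T, hN.irred⟩, hE ▸ reflTransGen_nf U, hN.irred⟩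

/-- A destructor application whose normal form is free of destructors is a redex. -/
theorem edrt_contract {f : Sym} {ts : Fin f.arity → Term}
    (hN : NoDestructor Edrt (Term.app f ts).contract) (hf : f.Destructor) :
    Edrt (.app f ts) (Term.app f ts).contract := by
  refine (Term.contract_cases _).resolve_right fun hE => ?_
  rw [hE] at hN
  exact hN.1 ((isDestructor_iff f).2 hf)

/-! ## Roles of names -/

/-- What a name is used for. A name that is not in use is `free`; the nonce of a launch by the CPU
carries the blocks of the platform state sent to the TPM and the measurement, the nonce of the
trusted `INIT` carries the platform state (with `PCR` value `y`) and the measurement. -/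
inductive Role
  | free | pub | key
  | launch (b c d m : Term)
  | init (y b c d m : Term)

abbrev Roles := ℕ → Role

/-- `ρ'` assigns roles to further names. -/
def Roles.Ext (ρ ρ' : Roles) : Prop := ∀ n, ρ n ≠ .free → ρ' n = ρ n

theorem Roles.Ext.refl (ρ : Roles) : ρ.Ext ρ := fun _ _ => rfl

theorem Roles.Ext.trans {ρ₁ ρ₂ ρ₃ : Roles} (h₁ : ρ₁.Ext ρ₂) (h₂ : ρ₂.Ext ρ₃) : ρ₁.Ext ρ₃ :=
  fun n hn => (h₂ n (h₁ n hn ▸ hn)).trans (h₁ n hn)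

theorem Roles.ext_update {ρ : Roles} {n : ℕ} (hn : ρ n = .free) (r : Role) :
    ρ.Ext (Function.update ρ n r) := fun k hk =>
  Function.update_of_ne (fun e => hk (by rw [e, hn])) _ _

theorem Roles.Ext.apply_eq {ρ ρ' : Roles} (hρ : ρ.Ext ρ') {n : ℕ} {r : Role} (hn : ρ n = r)
    (hr : r ≠ .free) : ρ' n = r :=
  (hρ n (hn ▸ hr)).trans hn

/-! ## Attacker knowledge -/

/-- The `PCR` value after a launch of the program `i` with the STM `s`. -/
abbrev launchPcr (i s : Term) : Term := h (tup ![pd, tup ![h i, h s]])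

/-- The constraint on the components of the platform states that the attacker may learn. -/
structure StateOk (pcr stm init pp lock : Term) : Prop where
  ne_pd : pcr ≠ pd
  ne_launch : pcr ≠ launchPcr (prog Tinit) (prog Tstm)
  of_hchain : pcr = hchain → stm = prog Tstm ∧ init = prog Tinit ∧ pp = prog Tpp ∧ lock = tt

/-- An upper bound on the normal forms that the attacker may learn. -/
inductive Known (ρ : Roles) : Term → Prop
  | var (x : Var) : Known ρ (.var x)
  | name {n : ℕ} : ρ n ≠ .free → ρ n ≠ .key → Known ρ (.name n)
  | app {f : Sym} {ts : Fin f.arity → Term} : ¬ f.IsPrivate → (∀ i, Known ρ (ts i)) →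
      Known ρ (.app f ts)
  -- Hashes of secrets are conceded too: no rule opens a hash, and `PCR` values and measurements
  -- then need no further check.
  | hash (a : Term) : Known ρ (h a)
  -- The key is arbitrary but the plaintext must be known, so decryption under any key reveals
  -- nothing new.
  | senc {a : Term} (b : Term) : Known ρ a → Known ρ (senc a b)
  -- The content may be secret, since only the private `unsealData` opens a seal.
  | sealed (a : Term) : Known ρ (sealData a hchain)
  | entry (i : ℕ) : Known ρ (prog (K (.entry i)))
  | tpm_ch {e : Term} : Known ρ e → Known ρ (tpm_ch (prog e))
  | state {y₀ y₁ y₂ y₃ y₄ y₅ y₆ y₇ : Term} : Known ρ y₀ → Known ρ y₁ → Known ρ y₂ → Known ρ y₃ →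
      Known ρ y₄ → Known ρ y₅ → Known ρ y₆ → Known ρ y₇ → StateOk y₀ y₃ y₅ y₆ y₇ →
      Known ρ (state (tpm y₀) (cpu y₁ y₂) (smram y₃ y₄) (drt y₅ y₆ y₇))

namespace Known

variable {ρ ρ' : Roles}

theorem mono (hρ : ρ.Ext ρ') {T : Term} (hT : Known ρ T) : Known ρ' T := by
  induction hT with
  | var x => exact .var x
  | name h₁ h₂ => exact .name (hρ _ h₁ ▸ h₁) (hρ _ h₁ ▸ h₂)
  | app hf _ ih => exact .app hf ih
  | hash a => exact .hash a
  | senc b _ ih => exact .senc b ih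
  | sealed a => exact .sealed a
  | entry i => exact .entry i
  | tpm_ch _ ih => exact .tpm_ch ih
  | state _ _ _ _ _ _ _ _ hS h₀ h₁ h₂ h₃ h₄ h₅ h₆ h₇ =>
    exact .state h₀ h₁ h₂ h₃ h₄ h₅ h₆ h₇ hS

theorem const {f : Sym} (hf : f.arity = 0) (hp : ¬ f.IsPrivate) : Known ρ (K f hf) :=
  .app hp fun i => absurd i.isLt (by omega)

theorem tup₂ {a b : Term} (ha : Known ρ a) (hb : Known ρ b) : Known ρ (tup ![a, b]) :=
  .app id (Fin.forall_fin_two.2 ⟨ha, hb⟩)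

theorem tup₃ {a b c : Term} (ha : Known ρ a) (hb : Known ρ b) (hc : Known ρ c) :
    Known ρ (tup ![a, b, c]) :=
  .app id fun i : Fin 3 => by fin_cases i <;> assumption

theorem tup₄ {a b c d : Term} (ha : Known ρ a) (hb : Known ρ b) (hc : Known ρ c)
    (hd : Known ρ d) : Known ρ (tup ![a, b, c, d]) :=
  .app id fun i : Fin 4 => by fin_cases i <;> assumption

theorem of_tup {n : ℕ} {ts : Fin (Sym.tup n).arity → Term} (hT : Known ρ (.app (.tup n) ts))
    (i : Fin (Sym.tup n).arity) : Known ρ (ts i) := by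
  generalize hU : Term.app (.tup n) ts = U at hT
  cases hT
  case app hts => cases hU; exact hts i
  all_goals nomatch hU

theorem of_senc {a b : Term} (hT : Known ρ (DRT.senc a b)) : Known ρ a := by
  generalize hU : DRT.senc a b = U at hT
  cases hT
  case app hts => cases hU; exact hts (0 : Fin 2)
  case senc ha => exact (senc_inj.1 hU).1 ▸ ha
  all_goals nomatch hU

theorem of_sealData {a b : Term} (hT : Known ρ (sealData a b)) : Known ρ a ∨ b = hchain := by
  generalize hU : sealData a b = U at hT
  cases hT
  case app hts => cases hU; exact .inl (hts (0 : Fin 2))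
  case sealed => exact .inr (sealData_inj.1 hU).2
  all_goals nomatch hU

theorem of_prog {a : Term} (hT : Known ρ (prog a)) : Known ρ a ∨ ∃ i, a = K (.entry i) := by
  generalize hU : prog a = U at hT
  cases hT
  case app hts => cases hU; exact .inl (hts (0 : Fin 1))
  case entry i => exact .inr ⟨i, prog_inj.1 hU⟩
  all_goals nomatch hU

theorem of_tpm_ch {a : Term} (hT : Known ρ (DRT.tpm_ch a)) : ∃ e, a = prog e ∧ Known ρ e := by
  generalize hU : DRT.tpm_ch a = U at hT
  cases hT
  case app hf _ => cases hU; exact (hf trivial).elim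
  case tpm_ch e he => exact ⟨e, tpm_ch_inj.1 hU, he⟩
  all_goals nomatch hU

theorem of_state {a b c d : Term} (hT : Known ρ (DRT.state a b c d)) :
    ∃ y₀ y₁ y₂ y₃ y₄ y₅ y₆ y₇, a = tpm y₀ ∧ b = cpu y₁ y₂ ∧ c = smram y₃ y₄ ∧ d = drt y₅ y₆ y₇ ∧
      Known ρ y₀ ∧ Known ρ y₁ ∧ Known ρ y₂ ∧ Known ρ y₃ ∧ Known ρ y₄ ∧ Known ρ y₅ ∧ Known ρ y₆ ∧
      Known ρ y₇ ∧ StateOk y₀ y₃ y₅ y₆ y₇ := by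
  generalize hU : DRT.state a b c d = U at hT
  cases hT
  case app hf _ => cases hU; exact (hf trivial).elim
  case state h₀ h₁ h₂ h₃ h₄ h₅ h₆ h₇ hS =>
    obtain ⟨rfl, rfl, rfl, rfl⟩ := state_inj.1 hU
    exact ⟨_, _, _, _, _, _, _, _, rfl, rfl, rfl, rfl, h₀, h₁, h₂, h₃, h₄, h₅, h₆, h₇, hS⟩
  all_goals nomatch hU

theorem of_name {n : ℕ} (hT : Known ρ (.name n)) : ρ n ≠ .free ∧ ρ n ≠ .key := by
  cases hT
  exact ⟨‹_›, ‹_›⟩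

theorem not_const {f : Sym} (hf : f.arity = 0) (hp : f.IsPrivate) : ¬ Known ρ (K f hf) := by
  intro hT
  generalize hU : K f hf = U at hT
  cases hT
  case app hq _ => cases hU; exact hq hp
  case var => nomatch hU
  case name => nomatch hU
  all_goals (injection hU with e _; subst e; exact absurd hf (by decide))

end Known

/-! ### Closure of the knowledge under public symbols -/

namespace StateOk

variable {y₀ y₃ y₅ y₆ y₇ : Term}

/-- The three conditions are closed under extension: each forbidden value that is a hash has a
forbidden value as its predecessor, and `pd` is no hash. Hence the new value is never `hchain` and
the other components are unconstrained. -/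
theorem extend (hS : StateOk y₀ y₃ y₅ y₆ y₇) (v y₃' y₅' y₆' y₇' : Term) :
    StateOk (h (tup ![y₀, v])) y₃' y₅' y₆' y₇' where
  ne_pd e := nomatch e
  ne_launch e := hS.ne_pd (tup2_inj.1 (h_inj.1 e)).1
  of_hchain e := (hS.ne_launch (tup2_inj.1 (h_inj.1 e)).1).elim

theorem ps (y₃ y₅ y₆ y₇ : Term) : StateOk ps y₃ y₅ y₆ y₇ where
  ne_pd e := nomatch e
  ne_launch e := nomatch e
  of_hchain e := nomatch e

theorem of_ne {y₃' y₅' y₆' y₇' : Term} (hS : StateOk y₀ y₃ y₅ y₆ y₇) (hne : y₀ ≠ hchain) :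
    StateOk y₀ y₃' y₅' y₆' y₇' where
  ne_pd := hS.ne_pd
  ne_launch := hS.ne_launch
  of_hchain e := (hne e).elim

end StateOk

theorem Edata.known {ρ : Roles} {f : Sym} {ts : Fin f.arity → Term} {W : Term}
    (hE : Edata (.app f ts) W) (hts : ∀ i, Known ρ (ts i)) (hf : ¬ f.IsPrivate) : Known ρ W := by
  generalize hU : Term.app f ts = U at hE
  cases hE <;> cases hU
  · exact Known.of_senc (hts (0 : Fin 2))
  · exact (hf trivial).elim

theorem Eprog.known {ρ : Roles} {f : Sym} {ts : Fin f.arity → Term} {W : Term}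
    (hE : Eprog (.app f ts) W) (hf : ¬ f.IsPrivate) : Known ρ W := by
  generalize hU : Term.app f ts = U at hE
  cases hE
  cases hU
  exact (hf trivial).elim

theorem not_known_tpm_acc {ρ : Roles} : ¬ Known ρ tpm_acc := Known.not_const _ trivial

theorem not_known_cpu_acc {ρ : Roles} : ¬ Known ρ cpu_acc := Known.not_const _ trivial

theorem not_known_cpu_tpm {ρ : Roles} : ¬ Known ρ cpu_tpm := Known.not_const _ trivial

theorem not_known_entry {ρ : Roles} (i : ℕ) : ¬ Known ρ (K (.entry i)) :=
  Known.not_const _ trivial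

/-- Writing with `tpm_acc` or `cpu_acc` is impossible, as these are unknown. The remaining writers
to a component constrained by `StateOk` are applicable only off `hchain`: `flush_stm` asks for lock
`ff` where `hchain` forces `tt`, while `set_pp` and `set_lock` ask for one of `Tinit`, `Tpp`,
`Tstm`, all unknown. -/
theorem Estate.known {ρ : Roles} {f : Sym} {ts : Fin f.arity → Term} {W : Term}
    (hE : Estate (.app f ts) W) (hts : ∀ i, Known ρ (ts i)) : Known ρ W := by
  generalize hU : Term.app f ts = U at hE
  cases hE <;> cases hU <;>
    obtain ⟨y₀, y₁, y₂, y₃, y₄, y₅, y₆, y₇, e₀, e₁, e₂, e₃, h₀, h₁, h₂, h₃, h₄, h₅, h₆, h₇, hS⟩ :=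
      Known.of_state (hts ⟨0, by decide⟩) <;>
    simp only [tpm_inj, cpu_inj, smram_inj, drt_inj] at e₀ e₁ e₂ e₃ <;>
    (try casesm* _ ∧ _) <;> subst_vars
  case pcr => exact h₀
  case int => exact h₁
  case cache => exact h₂
  case stm => exact h₃
  case smi => exact h₄
  case init => exact h₅
  case pp => exact h₆
  case lock => exact h₇
  case reset_ps => exact .state (hts (2 : Fin 3)) h₁ h₂ h₃ h₄ h₅ h₆ h₇ (.ps ..)
  case reset_pd => exact (not_known_tpm_acc (hts (1 : Fin 3))).elim
  case extend => exact (not_known_tpm_acc (hts (1 : Fin 3))).elim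
  case set_pcr => exact (not_known_tpm_acc (hts (1 : Fin 3))).elim
  case set_int_cpu => exact (not_known_cpu_acc (hts (1 : Fin 3))).elim
  case set_int_pp => exact .state h₀ (hts (2 : Fin 3)) h₂ h₃ h₄ h₅ h₆ h₇ hS
  case set_cache => exact .state h₀ h₁ (hts (1 : Fin 2)) h₃ h₄ h₅ h₆ h₇ hS
  case flush_stm =>
    exact .state h₀ h₁ h₂ h₂ h₄ h₅ h₆ h₇ (hS.of_ne fun e => nomatch (hS.of_hchain e).2.2.2)
  case flush_smi => exact .state h₀ h₁ h₂ h₃ h₂ h₅ h₆ h₇ hS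
  case set_init => exact (not_known_cpu_acc (hts (1 : Fin 3))).elim
  case set_pp_cpu => exact (not_known_cpu_acc (hts (1 : Fin 3))).elim
  case set_pp_init =>
    refine .state h₀ h₁ h₂ h₃ h₄ h₅ (hts (2 : Fin 3)) h₇ (hS.of_ne fun e => ?_)
    exact not_known_entry 0 (prog_inj.1 (hS.of_hchain e).2.1 ▸ hts (1 : Fin 3))
  case set_pp_smi =>
    refine .state h₀ h₁ h₂ h₃ h₄ h₅ (hts (2 : Fin 3)) h₇ (hS.of_ne fun e => ?_)
    exact not_known_entry 2
      (prog_inj.1 (hS.of_hchain e).1 ▸ Known.of_tup (hts (1 : Fin 3)) (0 : Fin 2))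
  case set_lock_cpu => exact (not_known_cpu_acc (hts (1 : Fin 3))).elim
  case set_lock_pp =>
    refine .state h₀ h₁ h₂ h₃ h₄ h₅ h₆ (hts (2 : Fin 3)) (hS.of_ne fun e => ?_)
    exact not_known_entry 1 (prog_inj.1 (hS.of_hchain e).2.2.1 ▸ hts (1 : Fin 3))
  case set_lock_smi =>
    refine .state h₀ h₁ h₂ h₃ h₄ h₅ h₆ (hts (2 : Fin 3)) (hS.of_ne fun e => ?_)
    exact not_known_entry 2
      (prog_inj.1 (hS.of_hchain e).1 ▸ Known.of_tup (hts (1 : Fin 3)) (0 : Fin 2))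

theorem Known.contract {ρ : Roles} {f : Sym} {ts : Fin f.arity → Term} (hf : ¬ f.IsPrivate)
    (hts : ∀ i, Known ρ (ts i)) : Known ρ (Term.app f ts).contract := by
  rcases Term.contract_cases (.app f ts) with hE | hE
  · rcases hE with hE | hE | hE
    exacts [hE.known hts hf, hE.known hf, hE.known hts]
  · exact hE.symm ▸ .app hf hts

theorem Deduces.known {ρ : Roles} {M : Set Term} (hM : ∀ T ∈ M, Known ρ T.nf) {T : Term}
    (hT : Deduces Edrt M T) : Known ρ T.nf := by
  induction hT with
  | ax hT hE => exact hE.nf_eq ▸ hM _ hT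
  | app hf _ hE ih => exact hE.nf_eq ▸ Known.contract hf ih
  | proj i _ hE ih =>
    rw [nf_app_of_not_destructor id] at ih
    exact hE.nf_eq ▸ ih.of_tup i

theorem Term.IsPublic.known_subst {ρ : Roles} {σ : Subst} (hσ : ∀ x, Known ρ (σ x).nf) {T : Term}
    (hT : T.IsPublic) (hn : ∀ n ∈ T.names, Known ρ (.name n)) : Known ρ (T.subst σ).nf := by
  induction T with
  | var x => exact hσ x
  | name n => exact hn n rfl
  | app f ts ih =>
    exact .contract hT.1 fun i => ih i (hT.2 i) fun n hi => hn n (Set.mem_iUnion.2 ⟨i, hi⟩)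

/-! ## Messages on channels -/

/-- The messages that may be sent on a channel that the attacker does not know. -/
inductive PrivMsg (ρ : Roles) : Term → Term → Prop
  | reset_req {n : ℕ} {y b c d m : Term} : ρ n = .launch b c d m →
      PrivMsg ρ cpu_tpm (tup ![K .reset_req, .name n, state (tpm y) b c d])
  | reset_resp {n : ℕ} {b c d m : Term} : ρ n = .launch b c d m →
      PrivMsg ρ cpu_tpm (tup ![K .reset_resp, .name n, state (tpm pd) b c d])
  | extend_req {n : ℕ} {b c d m : Term} : ρ n = .launch b c d m →
      PrivMsg ρ cpu_tpm (tup ![K .extend_req, .name n, state (tpm pd) b c d, m])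
  | extend_resp {n : ℕ} {b c d m : Term} : ρ n = .launch b c d m →
      PrivMsg ρ cpu_tpm (tup ![K .extend_resp, .name n, state (tpm (h (tup ![pd, m]))) b c d])
  | ext_channel (a : Term) : PrivMsg ρ cpu_tpm (tup ![K .ext_channel, tpm_ch a])
  | init_req {n : ℕ} {y b c d m : Term} : ρ n = .init y b c d m →
      PrivMsg ρ (tpm_ch (prog Tinit)) (tup ![K .extend_req, .name n, state (tpm y) b c d, m])
  | init_resp {n : ℕ} {y b c d m : Term} : ρ n = .init y b c d m →
      PrivMsg ρ (tpm_ch (prog Tinit))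
        (tup ![K .extend_resp, .name n, state (tpm (h (tup ![y, m]))) b c d])
  | unsealing (a : Term) : PrivMsg ρ (tpm_ch (prog Tpp)) (tup ![K .tag_unsealing, a])
  | plain (a : Term) : PrivMsg ρ (tpm_ch (prog Tpp)) (tup ![K .tag_plain, a])
  | pp_req (a : Term) {s : Term} : Known ρ s →
      PrivMsg ρ (tpm_ch (prog Tpp)) (tup ![K .extend_req, a, s, bot])
  | pp_resp (a : Term) {y b c d : Term} : Known ρ (state (tpm (h (tup ![y, bot]))) b c d) →
      PrivMsg ρ (tpm_ch (prog Tpp))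
        (tup ![K .extend_resp, a, state (tpm (h (tup ![y, bot]))) b c d])
  | launch {a y₁ y₂ y₃ y₄ y₆ p : Term} : Known ρ y₁ → Known ρ y₂ → Known ρ y₃ → Known ρ y₄ →
      Known ρ y₆ → Known ρ p →
      PrivMsg ρ Tinit (tup ![a, state (tpm (launchPcr (prog Tinit) y₃)) (cpu y₁ y₂) (smram y₃ y₄)
        (drt (prog Tinit) y₆ tt), tpm_ch (prog Tinit), p])
  | drt_resp (a b : Term) {s : Term} : Known ρ s → PrivMsg ρ Tinit (tup ![a, b, s])
  -- The attacker may have any private entry point launched or run in the wrong place. The resulting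
  -- messages need no constraint: no trusted process accepts a quadruple at an entry point other
  -- than `Tinit`, nor a pair at one other than `Tpp`.
  | launch_other {j : ℕ} (hj : j ≠ 0) (a b c d : Term) :
      PrivMsg ρ (K (.entry j)) (tup ![a, b, c, d])
  | run {s : Term} : Known ρ s → PrivMsg ρ Tpp (tup ![s, tpm_ch (prog Tpp)])
  | run_other {j : ℕ} (hj : j ≠ 1) (a b : Term) : PrivMsg ρ (K (.entry j)) (tup ![a, b])

theorem PrivMsg.mono {ρ ρ' : Roles} (hρ : ρ.Ext ρ') {c T : Term} (hT : PrivMsg ρ c T) :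
    PrivMsg ρ' c T := by
  cases hT with
  | reset_req hn => exact .reset_req (hρ.apply_eq hn nofun)
  | reset_resp hn => exact .reset_resp (hρ.apply_eq hn nofun)
  | extend_req hn => exact .extend_req (hρ.apply_eq hn nofun)
  | extend_resp hn => exact .extend_resp (hρ.apply_eq hn nofun)
  | ext_channel a => exact .ext_channel a
  | init_req hn => exact .init_req (hρ.apply_eq hn nofun)
  | init_resp hn => exact .init_resp (hρ.apply_eq hn nofun)
  | unsealing a => exact .unsealing a
  | plain a => exact .plain a
  | pp_req a hs => exact .pp_req a (hs.mono hρ)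
  | pp_resp a hs => exact .pp_resp a (hs.mono hρ)
  | launch h₁ h₂ h₃ h₄ h₆ hp =>
    exact .launch (h₁.mono hρ) (h₂.mono hρ) (h₃.mono hρ) (h₄.mono hρ) (h₆.mono hρ) (hp.mono hρ)
  | drt_resp a b hs => exact .drt_resp a b (hs.mono hρ)
  | launch_other hj a b c d => exact .launch_other hj a b c d
  | run hs => exact .run (hs.mono hρ)
  | run_other hj a b => exact .run_other hj a b

theorem not_known_tpm_ch_entry {ρ : Roles} (i : ℕ) : ¬ Known ρ (tpm_ch (prog (K (.entry i)))) := by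
  intro hc
  obtain ⟨e, he, hk⟩ := hc.of_tpm_ch
  exact not_known_entry i (prog_inj.1 he ▸ hk)

/-- This makes the alternatives of `MsgOk` exclusive: whether the channel is known decides which
bound a received message obeys. -/
theorem PrivMsg.not_known {ρ : Roles} {c T : Term} (hT : PrivMsg ρ c T) : ¬ Known ρ c := by
  cases hT
  all_goals first
    | exact not_known_cpu_tpm
    | exact not_known_entry _
    | exact not_known_tpm_ch_entry _

/-- `T` may be sent on the channel `c`. -/
def MsgOk (ρ : Roles) (c T : Term) : Prop := (Known ρ c ∧ Known ρ T) ∨ PrivMsg ρ c T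

theorem MsgOk.mono {ρ ρ' : Roles} (hρ : ρ.Ext ρ') {c T : Term} (hT : MsgOk ρ c T) :
    MsgOk ρ' c T :=
  hT.imp (fun hh => ⟨hh.1.mono hρ, hh.2.mono hρ⟩) (·.mono hρ)

theorem MsgOk.known {ρ : Roles} {c T : Term} (hT : MsgOk ρ c T) (hc : Known ρ c) : Known ρ T := by
  rcases hT with hT | hT
  exacts [hT.2, (hT.not_known hc).elim]

theorem MsgOk.priv {ρ : Roles} {c T : Term} (hT : MsgOk ρ c T) (hc : ¬ Known ρ c) :
    PrivMsg ρ c T :=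
  hT.resolve_left fun hh => hc hh.1

/-! ## Safe processes -/

/-- `Pσ` sends only admissible messages as long as it receives only admissible ones. -/
def Safe : Proc → Roles → Subst → Prop
  | .nil, _, _ => True
  | .par P Q, ρ, σ => Safe P ρ σ ∧ Safe Q ρ σ
  | .repl P, ρ, σ => Safe P ρ σ
  -- The role is chosen by the process, except that the restriction of the sealed key, recognized by
  -- its syntax as in `AttNew`, must choose `.key`.
  | .new x P, ρ, σ => ∀ ρ', ρ.Ext ρ' → ∀ n, ρ' n = .free →
      ∃ r, r ≠ .free ∧ (x = .kpp → P = DATA_body → r = .key) ∧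
        Safe P (Function.update ρ' n r) (Function.update σ x (.name n))
  | .inp U A P, ρ, σ => ∀ ρ', ρ.Ext ρ' → ∀ σ' : Subst, (∀ x, x ∉ A.binds → σ' x = σ x) →
      (∀ x ∈ A.binds, (σ' x).nf = σ' x) →
      MsgOk ρ' (U.subst σ).nf (A.toTerm.subst σ').nf → Safe P ρ' σ'
  | .out U T P, ρ, σ => MsgOk ρ (U.subst σ).nf (T.subst σ).nf ∧ Safe P ρ σ
  -- The branches use different conditions because equality of `nf` is shown to imply `EqE` only for
  -- destructor-free normal forms.
  | .ite U W P Q, ρ, σ => ((U.subst σ).nf = (W.subst σ).nf → Safe P ρ σ) ∧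
      (¬ EqE Edrt (U.subst σ) (W.subst σ) → Safe Q ρ σ)
  | .letIn x T P, ρ, σ => ∀ T', (T.subst σ).nf = T' → NoDestructor Edrt T' → T'.nf = T' →
      Safe P ρ (Function.update σ x T')

/-- Inputs and restrictions already quantify over all later role assignments; outputs are monotone.
Hence a process stays safe while others create names. -/
theorem Safe.mono {ρ ρ' : Roles} (hρ : ρ.Ext ρ') {P : Proc} {σ : Subst} (hP : Safe P ρ σ) :
    Safe P ρ' σ := by
  induction P generalizing σ with
  | nil => trivial
  | par P Q ihP ihQ => exact ⟨ihP hP.1, ihQ hP.2⟩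
  | repl P ih => exact ih hP
  | new x P ih => exact fun ρ'' h' => hP ρ'' (hρ.trans h')
  | inp U A P ih => exact fun ρ'' h' => hP ρ'' (hρ.trans h')
  | out U T P ih => exact ⟨hP.1.mono hρ, ih hP.2⟩
  | ite U W P Q ihP ihQ => exact ⟨fun e => ihP (hP.1 e), fun e => ihQ (hP.2 e)⟩
  | letIn x T P ih => exact fun T' h₁ h₂ h₃ => ih (hP T' h₁ h₂ h₃)

/-- The invariant of the configurations. -/
structure Config.Ok (ρ : Roles) (C : Config) : Prop where
  free : ∀ n, n ∉ C.N → ρ n = .free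
  known : ∀ T ∈ C.M, Known ρ T.nf
  safe : ∀ p ∈ C.procs, Safe p.2 ρ p.1

/-- Stated apart from the other steps because secrecy needs the role given to the name created at
this very step. -/
theorem Config.Ok.new {ρ : Roles} {N : Set ℕ} {M : Set Term} {Ps : Multiset (Subst × Proc)}
    {σ : Subst} {x : Var} {P : Proc} (hC : Config.Ok ρ ⟨N, M, (σ, .new x P) ::ₘ Ps⟩) {n : ℕ}
    (hn : n ∉ N) : ∃ ρ', (x = .kpp → P = DATA_body → ρ' n = .key) ∧ ρ.Ext ρ' ∧
      Config.Ok ρ' ⟨N ∪ {n}, M, (Function.update σ x (.name n), P) ::ₘ Ps⟩ := by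
  obtain ⟨hP, hPs⟩ := Multiset.forall_mem_cons.1 hC.safe
  have hfree := hC.free n hn
  obtain ⟨r, _, hkey, hsafe⟩ := hP ρ (.refl ρ) n hfree
  have hext := Roles.ext_update hfree r
  refine ⟨_, fun h₁ h₂ => by simpa using hkey h₁ h₂, hext, fun k hk => ?_,
    fun T hT => (hC.known T hT).mono hext,
    Multiset.forall_mem_cons.2 ⟨hsafe, fun p hp => (hPs p hp).mono hext⟩⟩
  simp only [Set.union_singleton, Set.mem_insert_iff, not_or] at hk
  rw [Function.update_of_ne hk.1]
  exact hC.free k hk.2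

theorem Config.Ok.step {ρ : Roles} {C C' : Config} (hC : C.Ok ρ) (hS : Step Edrt C C') :
    ∃ ρ', ρ.Ext ρ' ∧ C'.Ok ρ' := by
  cases hS with
  | nil N M Ps σ =>
    exact ⟨ρ, .refl ρ, hC.free, hC.known, (Multiset.forall_mem_cons.1 hC.safe).2⟩
  | bang N M Ps σ P =>
    have hP := Multiset.forall_mem_cons.1 hC.safe
    exact ⟨ρ, .refl ρ, hC.free, hC.known, Multiset.forall_mem_cons.2 ⟨hP.1, hC.safe⟩⟩
  | par N M Ps σ P Q =>
    have hP := Multiset.forall_mem_cons.1 hC.safe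
    exact ⟨ρ, .refl ρ, hC.free, hC.known,
      Multiset.forall_mem_cons.2 ⟨hP.1.1, Multiset.forall_mem_cons.2 ⟨hP.1.2, hP.2⟩⟩⟩
  | new N M Ps σ x P n hn =>
    obtain ⟨ρ', -, hext, hC'⟩ := hC.new hn
    exact ⟨ρ', hext, hC'⟩
  | comm N M Ps σ U T P τ U' A Q τ' hU hA =>
    obtain ⟨hP, hQ⟩ := Multiset.forall_mem_cons.1 hC.safe
    obtain ⟨hQ, hPs⟩ := Multiset.forall_mem_cons.1 hQ
    refine ⟨ρ, .refl ρ, hC.free, ?_, ?_⟩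
    · rintro W (hW | ⟨hd, rfl⟩)
      · exact hC.known W hW
      -- A message is revealed only if its channel is deducible, hence known, and known channels
      -- carry known messages.
      · exact hP.1.known (hd.known hC.known)
    · refine Multiset.forall_mem_cons.2 ⟨hP.2, Multiset.forall_mem_cons.2 ⟨?_, hPs⟩⟩
      refine hQ ρ (.refl ρ) τ' hA.1 (fun x hx => (hA.2.1 x hx).nf_eq) ?_
      rw [← hU.nf_eq, ← hA.2.2.nf_eq]
      exact hP.1
  | ifTrue N M Ps σ U W P Q hE =>
    have hP := Multiset.forall_mem_cons.1 hC.safe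
    exact ⟨ρ, .refl ρ, hC.free, hC.known,
      Multiset.forall_mem_cons.2 ⟨hP.1.1 hE.nf_eq, hP.2⟩⟩
  | ifFalse N M Ps σ U W P Q hE =>
    have hP := Multiset.forall_mem_cons.1 hC.safe
    exact ⟨ρ, .refl ρ, hC.free, hC.known, Multiset.forall_mem_cons.2 ⟨hP.1.2 hE, hP.2⟩⟩
  | letIn N M Ps σ x T P T' hT hN =>
    have hP := Multiset.forall_mem_cons.1 hC.safe
    exact ⟨ρ, .refl ρ, hC.free, hC.known,
      Multiset.forall_mem_cons.2 ⟨hP.1 T' hT.nf_eq hN hT.2.nf_eq, hP.2⟩⟩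

theorem Config.Ok.steps {ρ : Roles} {C C' : Config} (hC : C.Ok ρ) (hS : Steps Edrt C C') :
    ∃ ρ', ρ.Ext ρ' ∧ C'.Ok ρ' := by
  induction hS with
  | refl => exact ⟨ρ, .refl ρ, hC⟩
  | tail _ hS ih =>
    obtain ⟨ρ₁, h₁, hC₁⟩ := ih
    obtain ⟨ρ₂, h₂, hC₂⟩ := hC₁.step hS
    exact ⟨ρ₂, h₁.trans h₂, hC₂⟩

/-! ## The attacker is safe -/

theorem Known.of_pat {ρ : Roles} {σ : Subst} {A : Pat} (hA : Known ρ (A.toTerm.subst σ).nf)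
    {x : Var} (hx : x ∈ A.binds) : Known ρ (σ x).nf := by
  induction A with
  | bind y => cases hx; exact hA
  | test T => exact hx.elim
  | tup As ih =>
    obtain ⟨i, hi⟩ := Set.mem_iUnion.1 hx
    simp only [Pat.toTerm, Term.subst] at hA
    rw [nf_app_of_not_destructor id] at hA
    exact ih i (hA.of_tup i) hi

/-- The private constant `Tpp` occurs in `hchain`. So no restriction of the attacker is forced to
take the role `.key`. -/
theorem not_isPublic_DATA_body : ¬ DATA_body.IsPublic := by
  intro hP
  have hT : (sealData (V .kpp) hchain).IsPublic := hP.2.2.1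
  have h₁ : hchain.IsPublic := hT.2 (1 : Fin 2)
  have h₂ : (h (prog Tpp)).IsPublic := (h₁.2 (0 : Fin 1)).2 (1 : Fin 2)
  exact ((h₂.2 (0 : Fin 1)).2 (0 : Fin 1)).1 trivial

/-- All terms that an attacker process evaluates are built by public symbols from known values, so
its channels and messages are known; its fresh names get the role `.pub`. -/
theorem Proc.IsPublic.safe {P : Proc} (hP : P.IsPublic) {ρ : Roles} {σ : Subst}
    (hσ : ∀ x, Known ρ (σ x).nf) (hn : ∀ n ∈ P.names, Known ρ (.name n)) : Safe P ρ σ := by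
  induction P generalizing ρ σ with
  | nil => trivial
  | par P Q ihP ihQ =>
    exact ⟨ihP hP.1 hσ fun n h' => hn n (.inl h'), ihQ hP.2 hσ fun n h' => hn n (.inr h')⟩
  | repl P ih => exact ih hP hσ hn
  | new x P ih =>
    intro ρ' hρ n hfree
    have hext := hρ.trans (Roles.ext_update hfree .pub)
    refine ⟨.pub, nofun, fun _ e => (not_isPublic_DATA_body (e ▸ hP)).elim,
      ih hP (fun y => ?_) fun k hk => (hn k hk).mono hext⟩
    by_cases hy : y = x
    · subst hy
      simpa using Known.name (n := n) (by simp) (by simp)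
    · simpa [hy] using (hσ y).mono hext
  | inp U A P ih =>
    intro ρ' hρ σ' h₁ h₂ hT
    have hU : Known ρ (U.subst σ).nf :=
      hP.1.known_subst hσ fun n h' => hn n (.inl (.inl h'))
    have hA := hT.known (hU.mono hρ)
    refine ih hP.2.2 (fun x => ?_) fun n h' => (hn n (.inr h')).mono hρ
    by_cases hx : x ∈ A.binds
    · exact hA.of_pat hx
    · exact h₁ x hx ▸ (hσ x).mono hρ
  | out U T P ih =>
    exact ⟨.inl ⟨hP.1.known_subst hσ fun n h' => hn n (.inl (.inl h')),
      hP.2.1.known_subst hσ fun n h' => hn n (.inl (.inr h'))⟩,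
      ih hP.2.2 hσ fun n h' => hn n (.inr h')⟩
  | ite U W P Q ihP ihQ =>
    exact ⟨fun _ => ihP hP.2.2.1 hσ fun n h' => hn n (.inl (.inr h')),
      fun _ => ihQ hP.2.2.2 hσ fun n h' => hn n (.inr h')⟩
  | letIn x T P ih =>
    intro T' hT _ hT'
    have hk : Known ρ T' := hT ▸ hP.1.known_subst hσ fun n h' => hn n (.inl h')
    refine ih hP.2 (fun y => ?_) fun n h' => hn n (.inr h')
    by_cases hy : y = x
    · subst hy
      simpa [hT'] using hk
    · simpa [hy] using hσ y

/-! ## Inversion of rules and messages -/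

theorem contract_set_int_cpu (x₁ y₁ y₂ x₂ x₃ v : Term) :
    (set_int (state x₁ (cpu y₁ y₂) x₂ x₃) cpu_acc v).contract = state x₁ (cpu v y₂) x₂ x₃ :=
  Edrt.contract_eq (.inr (.inr (.set_int_cpu ..)))

theorem contract_set_lock_cpu (x₁ x₂ x₃ y₁ y₂ y₃ v : Term) :
    (set_lock (state x₁ x₂ x₃ (drt y₁ y₂ y₃)) cpu_acc v).contract =
      state x₁ x₂ x₃ (drt y₁ y₂ v) :=
  Edrt.contract_eq (.inr (.inr (.set_lock_cpu ..)))

theorem contract_set_init (x₁ x₂ x₃ y₁ y₂ y₃ v : Term) :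
    (set_init (state x₁ x₂ x₃ (drt y₁ y₂ y₃)) cpu_acc v).contract =
      state x₁ x₂ x₃ (drt v y₂ y₃) :=
  Edrt.contract_eq (.inr (.inr (.set_init ..)))

theorem contract_stm (x₁ x₂ y₁ y₂ x₃ : Term) :
    (stm (state x₁ x₂ (smram y₁ y₂) x₃)).contract = y₁ :=
  Edrt.contract_eq (.inr (.inr (.stm ..)))

theorem Edrt.inv_reset {a b c W : Term} (hE : Edrt (reset a b c) W) :
    ∃ y x₁ x₂ x₃, a = state (tpm y) x₁ x₂ x₃ ∧ W = state (tpm c) x₁ x₂ x₃ := by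
  generalize hU : reset a b c = U at hE
  rcases hE with hE | hE | hE <;> cases hE <;> solve
    | cases hU
    | (obtain ⟨rfl, rfl, rfl⟩ := reset_inj.1 hU; exact ⟨_, _, _, _, rfl, rfl⟩)

theorem Edrt.inv_extend {a b c W : Term} (hE : Edrt (extend a b c) W) :
    ∃ y x₁ x₂ x₃, a = state (tpm y) x₁ x₂ x₃ ∧ W = state (tpm (h (tup ![y, c]))) x₁ x₂ x₃ := by
  generalize hU : extend a b c = U at hE
  rcases hE with hE | hE | hE <;> cases hE <;> solve
    | cases hU
    | (obtain ⟨rfl, rfl, rfl⟩ := extend_inj.1 hU; exact ⟨_, _, _, _, rfl, rfl⟩)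

theorem Edrt.inv_get_entry {a W : Term} (hE : Edrt (get_entry a) W) : a = prog W := by
  generalize hU : get_entry a = U at hE
  rcases hE with hE | hE | hE <;> cases hE <;> solve
    | cases hU
    | exact get_entry_inj.1 hU

theorem Edrt.inv_unsealData {a b W : Term} (hE : Edrt (unsealData a b) W) : a = sealData W b := by
  generalize hU : unsealData a b = U at hE
  rcases hE with hE | hE | hE <;> cases hE <;> solve
    | cases hU
    | (obtain ⟨rfl, rfl⟩ := unsealData_inj.1 hU; rfl)

theorem Edrt.inv_sdec {a b W : Term} (hE : Edrt (sdec a b) W) : a = senc W b := by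
  generalize hU : sdec a b = U at hE
  rcases hE with hE | hE | hE <;> cases hE <;> solve
    | cases hU
    | (obtain ⟨rfl, rfl⟩ := sdec_inj.1 hU; rfl)

theorem Edrt.inv_lock {a W : Term} (hE : Edrt (lock a) W) :
    ∃ x₁ x₂ x₃ y₁ y₂, a = state x₁ x₂ x₃ (drt y₁ y₂ W) := by
  generalize hU : lock a = U at hE
  rcases hE with hE | hE | hE <;> cases hE <;> solve
    | cases hU
    | (obtain rfl := lock_inj.1 hU; exact ⟨_, _, _, _, _, rfl⟩)

theorem Edrt.inv_pcr {a W : Term} (hE : Edrt (pcr a) W) :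
    ∃ x₁ x₂ x₃, a = state (tpm W) x₁ x₂ x₃ := by
  generalize hU : pcr a = U at hE
  rcases hE with hE | hE | hE <;> cases hE <;> solve
    | cases hU
    | (obtain rfl := pcr_inj.1 hU; exact ⟨_, _, _, rfl⟩)

theorem Edrt.inv_pp {a W : Term} (hE : Edrt (pp a) W) :
    ∃ x₁ x₂ x₃ y₁ y₂, a = state x₁ x₂ x₃ (drt y₁ W y₂) := by
  generalize hU : pp a = U at hE
  rcases hE with hE | hE | hE <;> cases hE <;> solve
    | cases hU
    | (obtain rfl := pp_inj.1 hU; exact ⟨_, _, _, _, _, rfl⟩)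

theorem Edrt.inv_set_int_Tpp {a c W : Term} (hE : Edrt (set_int a Tpp c) W) :
    ∃ x₁ y z x₂ z₁, a = state x₁ (cpu y z) x₂ (drt z₁ (prog Tpp) tt) ∧
      W = state x₁ (cpu c z) x₂ (drt z₁ (prog Tpp) tt) := by
  generalize hU : set_int a Tpp c = U at hE
  rcases hE with hE | hE | hE <;> cases hE <;> solve
    | cases hU
    | (have e := (set_int_inj.1 hU).2.1; cases e)
    | (obtain ⟨rfl, rfl, rfl⟩ := set_int_inj.1 hU; exact ⟨_, _, _, _, _, rfl, rfl⟩)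

/-- The constant `Tpp` is neither `cpu_acc` nor a pair, so only the rule for the protected program
applies. -/
theorem Edrt.inv_set_lock_Tpp {a c W : Term} (hE : Edrt (set_lock a Tpp c) W) :
    ∃ x₁ x₂ x₃ y₁ y₂ y₃, a = state x₁ x₂ x₃ (drt y₁ y₂ y₃) ∧
      W = state x₁ x₂ x₃ (drt y₁ y₂ c) := by
  generalize hU : set_lock a Tpp c = U at hE
  rcases hE with hE | hE | hE <;> cases hE <;> solve
    | cases hU
    | (have e := (set_lock_inj.1 hU).2.1; cases e)
    | (obtain ⟨rfl, rfl, rfl⟩ := set_lock_inj.1 hU; exact ⟨_, _, _, _, _, _, rfl, rfl⟩)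

namespace PrivMsg

variable {ρ : Roles}

theorem inv_reset_req {a s : Term} (hT : PrivMsg ρ cpu_tpm (tup ![K .reset_req, a, s])) :
    ∃ n y b c d m, a = .name n ∧ s = state (tpm y) b c d ∧ ρ n = .launch b c d m := by
  generalize hc : cpu_tpm = e at hT
  generalize hU : tup ![K .reset_req, a, s] = U at hT
  cases hT <;> solve
    | cases hc
    | cases hU
    | (have e := (tup3_inj.1 hU).1; cases e)
    | (obtain ⟨-, rfl, rfl⟩ := tup3_inj.1 hU; exact ⟨_, _, _, _, _, _, rfl, rfl, ‹_›⟩)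

theorem inv_reset_resp {a s : Term} (hT : PrivMsg ρ cpu_tpm (tup ![K .reset_resp, a, s])) :
    ∃ n b c d m, a = .name n ∧ s = state (tpm pd) b c d ∧ ρ n = .launch b c d m := by
  generalize hc : cpu_tpm = e at hT
  generalize hU : tup ![K .reset_resp, a, s] = U at hT
  cases hT <;> solve
    | cases hc
    | cases hU
    | (have e := (tup3_inj.1 hU).1; cases e)
    | (obtain ⟨-, rfl, rfl⟩ := tup3_inj.1 hU; exact ⟨_, _, _, _, _, rfl, rfl, ‹_›⟩)

theorem inv_extend_req {a s v : Term} (hT : PrivMsg ρ cpu_tpm (tup ![K .extend_req, a, s, v])) :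
    ∃ n b c d, a = .name n ∧ s = state (tpm pd) b c d ∧ ρ n = .launch b c d v := by
  generalize hc : cpu_tpm = e at hT
  generalize hU : tup ![K .extend_req, a, s, v] = U at hT
  cases hT <;> solve
    | cases hc
    | cases hU
    | (obtain ⟨-, rfl, rfl, rfl⟩ := tup4_inj.1 hU; exact ⟨_, _, _, _, rfl, rfl, ‹_›⟩)

theorem inv_extend_resp {a s : Term} (hT : PrivMsg ρ cpu_tpm (tup ![K .extend_resp, a, s])) :
    ∃ n b c d m, a = .name n ∧ s = state (tpm (h (tup ![pd, m]))) b c d ∧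
      ρ n = .launch b c d m := by
  generalize hc : cpu_tpm = e at hT
  generalize hU : tup ![K .extend_resp, a, s] = U at hT
  cases hT <;> solve
    | cases hc
    | cases hU
    | (have e := (tup3_inj.1 hU).1; cases e)
    | (obtain ⟨-, rfl, rfl⟩ := tup3_inj.1 hU; exact ⟨_, _, _, _, _, rfl, rfl, ‹_›⟩)

theorem inv_ext_channel {a : Term} (hT : PrivMsg ρ cpu_tpm (tup ![K .ext_channel, a])) :
    ∃ x, a = tpm_ch x := by
  generalize hc : cpu_tpm = e at hT
  generalize hU : tup ![K .ext_channel, a] = U at hT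
  cases hT <;> solve
    | cases hc
    | cases hU
    | exact ⟨_, (tup2_inj.1 hU).2⟩

theorem inv_tpm_ch_extend_req {x a s v : Term}
    (hT : PrivMsg ρ (tpm_ch x) (tup ![K .extend_req, a, s, v])) :
    (x = prog Tinit ∧ ∃ n y b c d, a = .name n ∧ s = state (tpm y) b c d ∧ ρ n = .init y b c d v) ∨
      (x = prog Tpp ∧ v = bot ∧ Known ρ s) := by
  generalize hc : tpm_ch x = e at hT
  generalize hU : tup ![K .extend_req, a, s, v] = U at hT
  cases hT
  case init_req =>
    obtain ⟨-, rfl, rfl, rfl⟩ := tup4_inj.1 hU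
    exact .inl ⟨tpm_ch_inj.1 hc, _, _, _, _, _, rfl, rfl, ‹_›⟩
  case pp_req =>
    obtain ⟨-, rfl, rfl, rfl⟩ := tup4_inj.1 hU
    exact .inr ⟨tpm_ch_inj.1 hc, rfl, ‹_›⟩
  all_goals solve
    | cases hc
    | cases hU

theorem inv_init_resp {a s : Term}
    (hT : PrivMsg ρ (tpm_ch (prog Tinit)) (tup ![K .extend_resp, a, s])) :
    ∃ n y b c d m, a = .name n ∧ s = state (tpm (h (tup ![y, m]))) b c d ∧
      ρ n = .init y b c d m := by
  generalize hc : tpm_ch (prog Tinit) = e at hT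
  generalize hU : tup ![K .extend_resp, a, s] = U at hT
  cases hT <;> solve
    | cases hc
    | cases hU
    | (have e := prog_inj.1 (tpm_ch_inj.1 hc); cases e)
    | (obtain ⟨-, rfl, rfl⟩ := tup3_inj.1 hU; exact ⟨_, _, _, _, _, _, rfl, rfl, ‹_›⟩)

theorem inv_pp_resp {a s : Term}
    (hT : PrivMsg ρ (tpm_ch (prog Tpp)) (tup ![K .extend_resp, a, s])) :
    ∃ y b c d, s = state (tpm (h (tup ![y, bot]))) b c d ∧ Known ρ s := by
  generalize hc : tpm_ch (prog Tpp) = e at hT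
  generalize hU : tup ![K .extend_resp, a, s] = U at hT
  cases hT <;> solve
    | cases hc
    | cases hU
    | (have e := prog_inj.1 (tpm_ch_inj.1 hc); cases e)
    | (obtain ⟨-, rfl, rfl⟩ := tup3_inj.1 hU; exact ⟨_, _, _, _, rfl, ‹_›⟩)

theorem inv_unsealing {x a : Term} (hT : PrivMsg ρ (tpm_ch x) (tup ![K .tag_unsealing, a])) :
    x = prog Tpp := by
  generalize hc : tpm_ch x = e at hT
  generalize hU : tup ![K .tag_unsealing, a] = U at hT
  cases hT <;> solve
    | cases hc
    | cases hU
    | exact tpm_ch_inj.1 hc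

/-- Tuple length separates the traffic on entry points: launches are quadruples, responses triples,
and calls of the protected program pairs. -/
theorem inv_launch {a s c p : Term} (hT : PrivMsg ρ Tinit (tup ![a, s, c, p])) :
    ∃ y₁ y₂ y₃ y₄ y₆, s = state (tpm (launchPcr (prog Tinit) y₃)) (cpu y₁ y₂) (smram y₃ y₄)
        (drt (prog Tinit) y₆ tt) ∧ c = tpm_ch (prog Tinit) ∧
      Known ρ y₁ ∧ Known ρ y₂ ∧ Known ρ y₃ ∧ Known ρ y₄ ∧ Known ρ y₆ ∧ Known ρ p := by
  generalize hc : Tinit = e at hT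
  generalize hU : tup ![a, s, c, p] = U at hT
  cases hT
  case launch h₁ h₂ h₃ h₄ h₆ hp =>
    obtain ⟨rfl, rfl, rfl, rfl⟩ := tup4_inj.1 hU
    exact ⟨_, _, _, _, _, rfl, rfl, h₁, h₂, h₃, h₄, h₆, hp⟩
  case launch_other hj _ _ _ _ =>
    injection hc with e _
    injection e with e
    exact (hj e.symm).elim
  all_goals solve
    | cases hc
    | cases hU

theorem inv_entry₃ {j : ℕ} {a b s : Term} (hT : PrivMsg ρ (K (.entry j)) (tup ![a, b, s])) :
    Known ρ s := by
  generalize hc : K (.entry j) = e at hT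
  generalize hU : tup ![a, b, s] = U at hT
  cases hT <;> solve
    | cases hc
    | cases hU
    | (obtain ⟨rfl, rfl, rfl⟩ := tup3_inj.1 hU; assumption)

theorem inv_run {s c : Term} (hT : PrivMsg ρ Tpp (tup ![s, c])) :
    c = tpm_ch (prog Tpp) ∧ Known ρ s := by
  generalize hc : Tpp = e at hT
  generalize hU : tup ![s, c] = U at hT
  cases hT
  case run hs =>
    obtain ⟨rfl, rfl⟩ := tup2_inj.1 hU
    exact ⟨rfl, hs⟩
  case run_other hj _ _ =>
    injection hc with e _
    injection e with e
    exact (hj e.symm).elim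
  all_goals solve
    | cases hc
    | cases hU

end PrivMsg

/-! ## Patterns -/

@[simp] theorem toTerm_bind (x : Var) : (Pat.bind x).toTerm = V x := rfl

@[simp] theorem toTerm_test (T : Term) : (Pat.test T).toTerm = T := rfl

@[simp] theorem toTerm_tup2 (A B : Pat) :
    (Pat.tup ![A, B]).toTerm = tup ![A.toTerm, B.toTerm] :=
  congrArg (Term.app (.tup 2)) (funext fun i => by fin_cases i <;> rfl)

@[simp] theorem toTerm_tup3 (A B C : Pat) :
    (Pat.tup ![A, B, C]).toTerm = tup ![A.toTerm, B.toTerm, C.toTerm] :=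
  congrArg (Term.app (.tup 3)) (funext fun i => by fin_cases i <;> rfl)

@[simp] theorem toTerm_tup4 (A B C D : Pat) :
    (Pat.tup ![A, B, C, D]).toTerm = tup ![A.toTerm, B.toTerm, C.toTerm, D.toTerm] :=
  congrArg (Term.app (.tup 4)) (funext fun i => by fin_cases i <;> rfl)

@[simp] theorem binds_bind (x : Var) : (Pat.bind x).binds = {x} := rfl

@[simp] theorem binds_test (T : Term) : (Pat.test T).binds = ∅ := rfl

@[simp] theorem binds_tup2 (A B : Pat) : (Pat.tup ![A, B]).binds = A.binds ∪ B.binds := by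
  ext x
  simp [Pat.binds, Fin.exists_fin_succ]

@[simp] theorem binds_tup3 (A B C : Pat) :
    (Pat.tup ![A, B, C]).binds = A.binds ∪ (B.binds ∪ C.binds) := by
  ext x
  simp [Pat.binds, Fin.exists_fin_succ]

@[simp] theorem binds_tup4 (A B C D : Pat) :
    (Pat.tup ![A, B, C, D]).binds = A.binds ∪ (B.binds ∪ (C.binds ∪ D.binds)) := by
  ext x
  simp [Pat.binds, Fin.exists_fin_succ]

/-! ## The trusted processes are safe -/

theorem known_os {ρ : Roles} : Known ρ os := .const rfl id

theorem known_tt {ρ : Roles} : Known ρ tt := .const rfl id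

theorem known_ff {ρ : Roles} : Known ρ ff := .const rfl id

theorem known_bot {ρ : Roles} : Known ρ bot := .const rfl id

/-- Platform states are closed under extension of the `PCR`. -/
theorem Known.extend_state {ρ : Roles} {y b c d : Term} (v : Term)
    (hS : Known ρ (DRT.state (tpm y) b c d)) :
    Known ρ (DRT.state (tpm (h (tup ![y, v]))) b c d) := by
  obtain ⟨y₀, y₁, y₂, y₃, y₄, y₅, y₆, y₇, e₀, rfl, rfl, rfl, _, h₁, h₂, h₃, h₄, h₅, h₆, h₇, hS⟩ :=
    hS.of_state
  obtain rfl := tpm_inj.1 e₀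
  exact .state (.hash _) h₁ h₂ h₃ h₄ h₅ h₆ h₇ (hS.extend ..)

theorem Known.reset_state {ρ : Roles} {y b c d : Term} (hS : Known ρ (DRT.state (tpm y) b c d)) :
    Known ρ (DRT.state (tpm ps) b c d) := by
  obtain ⟨y₀, y₁, y₂, y₃, y₄, y₅, y₆, y₇, -, rfl, rfl, rfl, _, h₁, h₂, h₃, h₄, h₅, h₆, h₇, -⟩ :=
    hS.of_state
  exact .state (.const rfl id) h₁ h₂ h₃ h₄ h₅ h₆ h₇ (.ps ..)

/-- On `cpu_tpm` the role of the nonce ties the answer to the state sent by the CPU. On `os` the new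
value is `ps`, which is never forbidden. -/
theorem safe_PCR_RESET {ρ : Roles} {σ : Subst}
    (hσ : (σ .ch = cpu_tpm ∧ σ .rv = pd) ∨ (σ .ch = os ∧ σ .rv = ps)) : Safe PCR_RESET ρ σ := by
  intro ρ' hρ σ' hne hnf hT T' hT' hN hn'
  simp at hne hnf hT hT'
  rw [← hne .ch (by decide) (by decide), ← hne .rv (by decide) (by decide)] at hσ
  rw [← hne .ch (by decide) (by decide)] at hT
  refine ⟨?_, trivial⟩
  rcases hσ with ⟨h₁, h₂⟩ | ⟨h₁, h₂⟩ <;> simp [h₁, h₂, hnf, hn', nf_reset] at hT hT' ⊢ <;>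
    subst hT' <;> obtain ⟨y, b, c, d, es, eT⟩ := (edrt_contract hN trivial).inv_reset <;> rw [eT]
  · obtain ⟨n, y', b', c', d', m, en, es', hn⟩ := (hT.priv not_known_cpu_tpm).inv_reset_req
    obtain ⟨-, rfl, rfl, rfl⟩ := state_inj.1 (es.symm.trans es')
    rw [en]
    exact .inr (.reset_resp hn)
  · have hk := hT.known known_os
    have hs : Known ρ' (σ' .pfState) := hk.of_tup (2 : Fin 3)
    rw [es] at hs
    exact .inl ⟨known_os, .tup₃ (.const rfl id) (hk.of_tup (1 : Fin 3)) hs.reset_state⟩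

theorem safe_TPM_RESET (ρ : Roles) (σ : Subst) : Safe TPM_RESET ρ σ := by
  refine ⟨?_, ?_⟩ <;> intro T₁ h₁ _ _ T₂ h₂ _ _ <;> refine safe_PCR_RESET ?_ <;>
    simp at h₁ h₂ ⊢ <;> simp [← h₁, ← h₂]

/-- On a known channel `Known.extend_state` suffices. On the private ones, the nonce identifies the
state and the measurement for the CPU and `INIT`; for `PP` it is enough that the state is known and
the value is `bot`. -/
theorem safe_PCR_EXTEND {ρ : Roles} {σ : Subst}
    (hσ : σ .ch = cpu_tpm ∨ σ .ch = os ∨ ∃ x, σ .ch = tpm_ch x ∧ x.nf = x) :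
    Safe PCR_EXTEND ρ σ := by
  intro ρ' hρ σ' hne hnf hT T' hT' hN hn'
  simp at hne hnf hT hT'
  rw [← hne .ch (by decide) (by decide) (by decide)] at hσ
  have hch : (σ' .ch).nf = σ' .ch := by
    rcases hσ with h₁ | h₁ | ⟨x, h₁, hx⟩ <;> simp [h₁]
    exact hx
  rw [← hne .ch (by decide) (by decide) (by decide)] at hT
  refine ⟨?_, trivial⟩
  simp [hch, hnf, hn', nf_extend] at hT hT' ⊢
  subst hT'
  obtain ⟨y, b, c, d, es, eT⟩ := (edrt_contract hN trivial).inv_extend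
  rw [eT]
  by_cases hc : Known ρ' (σ' .ch)
  · have hk := hT.known hc
    have hs : Known ρ' (σ' .pfState) := hk.of_tup (2 : Fin 4)
    rw [es] at hs
    exact .inl ⟨hc, .tup₃ (.const rfl id) (hk.of_tup (1 : Fin 4)) (hs.extend_state _)⟩
  replace hT := hT.priv hc
  rcases hσ with h₁ | h₁ | ⟨x, h₁, -⟩ <;> rw [h₁] at hT hc ⊢
  · obtain ⟨n, b', c', d', en, es', hn⟩ := hT.inv_extend_req
    obtain ⟨ey, rfl, rfl, rfl⟩ := state_inj.1 (es.symm.trans es')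
    rw [en, tpm_inj.1 ey]
    exact .inr (.extend_resp hn)
  · exact (hc known_os).elim
  · rcases hT.inv_tpm_ch_extend_req with ⟨rfl, n, y', b', c', d', en, es', hn⟩ | ⟨rfl, ev, hs⟩
    · obtain ⟨ey, rfl, rfl, rfl⟩ := state_inj.1 (es.symm.trans es')
      rw [en, tpm_inj.1 ey]
      exact .inr (.init_resp hn)
    · rw [es] at hs
      rw [ev]
      exact .inr (.pp_resp _ (hs.extend_state _))

theorem safe_TPM_EXTEND (ρ : Roles) (σ : Subst) : Safe TPM_EXTEND ρ σ := by
  refine ⟨?_, ?_, ?_⟩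
  · intro T₁ h₁ _ _
    refine safe_PCR_EXTEND (.inl ?_)
    simpa using h₁.symm
  · intro T₁ h₁ _ _
    refine safe_PCR_EXTEND (.inr (.inl ?_))
    simpa using h₁.symm
  · intro ρ' hρ σ' hne hnf hT
    simp at hne hnf hT
    rw [hnf] at hT
    obtain ⟨x, hx⟩ := (hT.priv not_known_cpu_tpm).inv_ext_channel
    refine safe_PCR_EXTEND (.inr (.inr ⟨x, hx, ?_⟩))
    rw [hx] at hnf
    simpa using hnf

/-- A known seal has known content unless it is sealed to `hchain`, and in that case `hs` makes the
answering channel private. -/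
theorem safe_UNSEAL {ρ : Roles} {σ : Subst} (hnf : (σ .ch).nf = σ .ch)
    (hs : ∀ p, (pcr (σ .pfState)).nf = p → p = hchain → σ .ch = tpm_ch (prog Tpp))
    (hσ : σ .ch = os ∨ ∃ x, σ .ch = tpm_ch x) : Safe UNSEAL ρ σ := by
  intro ρ' hρ σ' hne hnf' hT T' hT' hN hn'
  simp at hne hnf' hT hT'
  rw [← hne .ch (by decide)] at hnf hσ hT hs
  rw [← hne .pfState (by decide)] at hs
  refine ⟨?_, trivial⟩
  simp [hnf, hnf', hn', nf_unsealData] at hT hT' ⊢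
  subst hT'
  have eb := (edrt_contract hN trivial).inv_unsealData
  by_cases hc : Known ρ' (σ' .ch)
  · have hk : Known ρ' (σ' .blob) := (hT.known hc).of_tup (1 : Fin 2)
    rw [eb] at hk
    refine .inl ⟨hc, .tup₂ (.const rfl id) (hk.of_sealData.resolve_right fun e => ?_)⟩
    rw [hs _ rfl e] at hc
    exact not_known_tpm_ch_entry _ hc
  · replace hT := hT.priv hc
    rcases hσ with h₁ | ⟨x, h₁⟩ <;> rw [h₁] at hT hc ⊢
    · exact (hc known_os).elim
    · obtain rfl := hT.inv_unsealing
      exact .inr (.plain _)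

/-- The link from integrity to secrecy: even a state forged by the attacker, once its `PCR` reads
`hchain`, directs the TPM to the private channel of the trusted `PP`. -/
theorem pcr_nf_eq_hchain {ρ : Roles} {s : Term} (hs : Known ρ s) (hn : s.nf = s)
    (hp : (pcr s).nf = hchain) : (lock s).nf = tt ∧ (pp s).nf = prog Tpp := by
  have hE : Edrt (pcr s) hchain := by
    rw [nf_pcr, hn] at hp
    rcases Term.contract_cases (pcr s) with hE | hE
    · exact hp ▸ hE
    · exact nomatch hE.symm.trans hp
  obtain ⟨b, c, d, rfl⟩ := hE.inv_pcr
  obtain ⟨y₀, y₁, y₂, y₃, y₄, y₅, y₆, y₇, e₀, rfl, rfl, rfl, -, -, -, -, -, -, -, -, hS⟩ :=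
    hs.of_state
  obtain ⟨rfl, rfl, rfl, rfl⟩ := hS.of_hchain (tpm_inj.1 e₀).symm
  rw [nf_lock, nf_pp, hn]
  exact ⟨Edrt.contract_eq (.inr (.inr (.lock ..))), Edrt.contract_eq (.inr (.inr (.pp ..)))⟩

theorem safe_TPM_UNSEAL (ρ : Roles) (σ : Subst) : Safe TPM_UNSEAL ρ σ := by
  intro ρ' hρ σ' hne hnf hT
  simp at hne hnf hT
  rw [hnf] at hT
  have hk := hT.known known_os
  refine ⟨fun hl => ?_, fun hl => ?_⟩
  · intro T' hT' _ hn'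
    simp at hT' hl
    refine safe_UNSEAL (by simpa using hn') ?_ (.inr ⟨_, by simpa using hT'.symm⟩)
    intro p hp e
    simp at hp ⊢
    rw [← hT', (pcr_nf_eq_hchain hk hnf (hp.trans e)).2]
  · intro T' hT' _ hn'
    simp at hT'
    subst hT'
    refine safe_UNSEAL (by simp) ?_ (.inl (by simp))
    intro p hp e
    simp at hp
    have := pcr_nf_eq_hchain hk hnf (hp.trans e)
    -- The public branch requires that the lock is not `tt`, which `hchain` excludes.
    refine (hl (.of_nf_eq ?_ ?_)).elim
    · simpa [this.1] using noDestructor_const (f := .true) rfl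
    · simp [this.1]

theorem safe_TPM (ρ : Roles) (σ : Subst) : Safe TPM ρ σ :=
  ⟨safe_TPM_RESET ρ σ, safe_TPM_EXTEND ρ σ, safe_TPM_UNSEAL ρ σ⟩

theorem MsgOk.os {ρ : Roles} {T : Term} (hT : Known ρ T) : MsgOk ρ os T := .inl ⟨known_os, hT⟩

theorem safe_INIT (ρ : Roles) (σ : Subst) : Safe INIT ρ σ := by
  refine ⟨?_, ?_, ?_⟩
  · simpa using MsgOk.os (.entry 0)
  · simpa using MsgOk.os (.entry 2)
  intro ρ₁ _ σ₁ hne₁ hnf₁ hT₁ T₂ hT₂ hN₂ hn₂ ρ₃ hρ₃ n hfree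
  simp at hne₁ hnf₁ hT₁ hT₂
  simp [hnf₁] at hT₁ hT₂
  obtain ⟨y₁, y₂, y₃, y₄, y₆, es, ec, h₁, h₂, h₃, h₄, h₆, hp⟩ :=
    (hT₁.priv (not_known_entry 0)).inv_launch
  -- The fresh nonce records the state received and the measurement `T₂`, so that the response
  -- carrying it must be this state extended with `T₂`.
  refine ⟨.init (launchPcr (prog Tinit) y₃) (cpu y₁ y₂) (smram y₃ y₄) (drt (prog Tinit) y₆ tt) T₂,
    nofun, nofun, ?_, ?_⟩
  · simp [hnf₁.2.2.1, hn₂, ec]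
    rw [es]
    exact .inr (.init_req (by simp))
  intro ρ₄ hρ₄ σ₄ hne₄ hnf₄ hT₄ T₅ hT₅ hN₅ hn₅
  simp at hne₄ hnf₄ hT₄ hT₅
  have hext : ρ₁.Ext ρ₄ := (hρ₃.trans (Roles.ext_update hfree _)).trans hρ₄
  have epp : σ₄ .pp = σ₁ .pp := by simp [hne₄]
  have enonce₁ : σ₄ .nonce1 = .name n := by simp [hne₄]
  simp [hnf₄, enonce₁, epp, ec] at hT₄ hT₅
  obtain ⟨k, y, b, c, d, m, ek, es', hk⟩ := (hT₄.priv (not_known_tpm_ch_entry 0)).inv_init_resp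
  cases ek
  have hr : ρ₄ n = _ := hρ₄.apply_eq (Function.update_self ..) nofun
  cases hr.symm.trans hk
  have hset : T₅ = state (tpm (h (tup ![launchPcr (prog Tinit) y₃, T₂]))) (cpu y₁ y₂)
      (smram y₃ y₄) (drt (prog Tinit) (σ₁ .pp) tt) := by
    rw [← hT₅, nf_set_pp, hnf₄, hnf₁.1, es', nf_const _ rfl]
    exact Edrt.contract_eq (.inr (.inr (.set_pp_init ..)))
  -- The only point where `hchain` can arise. By injectivity of the constructors, equality forces
  -- the measured STM and protected program to be the trusted ones.
  have hS : StateOk (h (tup ![launchPcr (prog Tinit) y₃, T₂])) y₃ (prog Tinit) (σ₁ .pp) tt := by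
    refine ⟨nofun, fun e => ?_, fun e => ?_⟩
    · have := (tup2_inj.1 (h_inj.1 e)).1
      cases this
    · rw [← hT₂, hchain] at e
      simp at e
      exact ⟨e.1, rfl, e.2, rfl⟩
  have hT : Known ρ₄ T₅ := by
    rw [hset]
    exact .state (.hash _) (h₁.mono hext) (h₂.mono hext) (h₃.mono hext) (h₄.mono hext) (.entry 0)
      (hp.mono hext) known_tt hS
  refine ⟨?_, ?_, trivial⟩
  · simp [hn₅]
    exact .inr (.drt_resp _ _ hT)
  · simpa [hn₅] using MsgOk.os hT

theorem safe_PP (ρ : Roles) (σ : Subst) : Safe PP ρ σ := by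
  refine ⟨?_, ?_⟩
  · simpa using MsgOk.os (.entry 1)
  intro ρ₁ _ σ₁ hne₁ hnf₁ hT₁ T₂ hT₂ hN₂ hn₂
  simp at hne₁ hnf₁ hT₁ hT₂
  simp [hnf₁, nf_set_int] at hT₁ hT₂
  obtain ⟨ec, hs₀⟩ := (hT₁.priv (not_known_entry 1)).inv_run
  -- Only the interrupt flag changes, and `StateOk` does not constrain it.
  have hs : Known ρ₁ T₂ := by
    subst hT₂
    obtain ⟨x₁, y, z, x₂, z₁, e₁, e₂⟩ := (edrt_contract hN₂ trivial).inv_set_int_Tpp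
    rw [e₁] at hs₀
    rw [e₂]
    obtain ⟨_, _, _, _, _, _, _, _, rfl, e, rfl, e', h₀, h₁, h₂, h₃, h₄, h₅, h₆, h₇, hS⟩ :=
      hs₀.of_state
    obtain ⟨rfl, rfl⟩ := cpu_inj.1 e
    obtain ⟨rfl, rfl, rfl⟩ := drt_inj.1 e'
    exact .state h₀ known_tt h₂ h₃ h₄ h₅ h₆ h₇ hS
  refine ⟨?_, ?_⟩
  · simpa [hn₂] using MsgOk.os hs
  intro ρ₃ hρ₃ σ₃ hne₃ hnf₃ hT₃ ρ₄ hρ₄ σ₄ hne₄ hnf₄ hT₄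
  simp at hne₃ hnf₃ hT₃ hne₄ hnf₄ hT₄
  have ec₄ : σ₄ .tpmc = tpm_ch (prog Tpp) := by simp [hne₄, hne₃, ec]
  have es₄ : σ₄ .pfSt = T₂ := by simp [hne₄, hne₃]
  rw [hnf₄] at hT₄
  have hx := hT₄.known known_os
  refine ⟨?_, ?_⟩
  · simp [ec₄]
    exact .inr (.unsealing _)
  intro ρ₅ hρ₅ σ₅ hne₅ hnf₅ hT₅ T₆ hT₆ hN₆ hn₆
  simp at hne₅ hnf₅ hT₅ hT₆
  have ex : σ₅ .xEnc = σ₄ .xEnc := hne₅ _ (by decide)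
  simp [nf_sdec, ex, hnf₄, hnf₅] at hT₆
  -- Whatever key was unsealed, the output is the plaintext of a ciphertext received on `os`, hence
  -- known.
  have hm : Known ρ₅ T₆ := by
    subst hT₆
    have e := (edrt_contract hN₆ trivial).inv_sdec
    rw [e] at hx
    exact hx.of_senc.mono hρ₅
  refine ⟨?_, ?_⟩
  · simpa [hn₆] using MsgOk.os hm
  intro ρ₇ hρ₇ n hfree
  have hs₇ : Known (Function.update ρ₇ n .pub) T₂ :=
    hs.mono ((((hρ₃.trans hρ₄).trans hρ₅).trans hρ₇).trans (Roles.ext_update hfree _))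
  have ec₅ : σ₅ .tpmc = tpm_ch (prog Tpp) := by simp [hne₅, ec₄]
  have es₅ : σ₅ .pfSt = T₂ := by simp [hne₅, es₄]
  refine ⟨.pub, nofun, nofun, ?_, ?_⟩
  · simp [ec₅, es₅, hn₂]
    exact .inr (.pp_req _ hs₇)
  intro ρ₈ hρ₈ σ₈ hne₈ hnf₈ hT₈ T₉ hT₉ hN₉ hn₉
  simp at hne₈ hnf₈ hT₈ hT₉
  simp [ec₅, hnf₈, nf_set_lock] at hT₈ hT₉
  obtain ⟨y, b, c, d, es, hk⟩ := (hT₈.priv (not_known_tpm_ch_entry 1)).inv_pp_resp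
  refine ⟨?_, trivial⟩
  simp [hn₉]
  refine .os ?_
  subst hT₉
  obtain ⟨x₁, x₂, x₃, z₁, z₂, z₃, e₁, e₂⟩ := (edrt_contract hN₉ trivial).inv_set_lock_Tpp
  rw [e₂]
  obtain ⟨rfl, rfl, rfl, rfl⟩ := state_inj.1 (es.symm.trans e₁)
  rw [es] at hk
  obtain ⟨_, _, _, _, _, _, _, _, e, rfl, rfl, e', h₀, h₁, h₂, h₃, h₄, h₅, h₆, h₇, hS⟩ :=
    hk.of_state
  obtain rfl := tpm_inj.1 e
  obtain ⟨rfl, rfl, rfl⟩ := drt_inj.1 e'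
  -- The last extension was by `bot`, which is not the measurement ending `hchain`, so the lock may
  -- be opened.
  refine .state h₀ h₁ h₂ h₃ h₄ h₅ h₆ known_ff (hS.of_ne fun e => ?_)
  have := (tup2_inj.1 (h_inj.1 e)).2
  cases this

theorem safe_DATA (ρ : Roles) (σ : Subst) : Safe DATA ρ σ := by
  intro ρ₁ _ n hn
  -- The key is used only inside `Known.senc` and `Known.sealed`, which ask nothing of it. The
  -- plaintext name below is conceded to the attacker with role `.pub`.
  refine ⟨.key, nofun, fun _ _ => rfl, ?_⟩
  intro ρ₂ _ k hk
  refine ⟨.pub, nofun, nofun, ?_, ?_⟩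
  · simp
    exact .os (.senc _ (.name (by simp) (by simp)))
  intro T hT _ hT'
  refine ⟨?_, trivial⟩
  simp at hT
  subst hT
  simp
  exact .os (.sealed _)

theorem safe_SETUP (ρ : Roles) (σ : Subst) : Safe SETUP ρ σ := by
  intro ρ₁ _ σ₁ hne₁ hnf₁ hT₁ ρ₂ hρ₂ σ₂ hne₂ hnf₂ hT₂
  simp at hne₁ hnf₁ hT₁ hne₂ hnf₂ hT₂
  have h₁ := hT₁.known known_os
  have h₂ := hT₂.known known_os
  have e : σ₂ .xStm = σ₁ .xStm := hne₂ _ (by decide)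
  refine ⟨?_, ?_⟩
  · simp [e]
    exact .os (.state (.const rfl id) known_tt known_bot (h₁.mono hρ₂) h₂ known_bot known_bot
      known_ff (.ps ..))
  intro ρ₃ _ σ₃ hne₃ hnf₃ hT₃ ρ₄ hρ₄ σ₄ hne₄ hnf₄ hT₄ ρ₅ hρ₅ σ₅ hne₅ hnf₅ hT₅
  simp at hne₃ hnf₃ hT₃ hne₄ hnf₄ hT₄ hne₅ hnf₅ hT₅
  have e₁ : σ₅ .init = σ₃ .init := by simp [hne₅, hne₄]
  have e₂ : σ₅ .pp = σ₄ .pp := by simp [hne₅]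
  refine ⟨?_, trivial⟩
  simp [e₁, e₂]
  exact .os (.tup₄ (.const rfl id) (((hT₃.known known_os).mono hρ₄).mono hρ₅)
    ((hT₄.known known_os).mono hρ₅) (hT₅.known known_os))

/-- The nonce forces both TPM responses to concern the CPU's own state, so the launched `PCR` value
matches the program and the STM in the state. What remains is to follow this state to the entry
point of the program. -/
theorem safe_CPU (ρ : Roles) (σ : Subst) : Safe CPU ρ σ := by
  intro ρ₁ _ σ₁ hne₁ hnf₁ hT₁
  simp at hne₁ hnf₁ hT₁
  obtain ⟨hns, hnp, hni⟩ := hnf₁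
  simp [hns, hnp, hni] at hT₁
  have hk := hT₁.known known_os
  have hi : Known ρ₁ (σ₁ .init) := hk.of_tup (1 : Fin 4)
  have hp : Known ρ₁ (σ₁ .pp) := hk.of_tup (2 : Fin 4)
  have hs : Known ρ₁ (σ₁ .pfState) := hk.of_tup (3 : Fin 4)
  refine ⟨fun hl => ?_, fun _ => trivial⟩
  simp [nf_lock, hns] at hl
  have hE := edrt_contract (f := .lock) (ts := (![σ₁ .pfState] : Fin 1 → Term))
    (hl ▸ noDestructor_const rfl) trivial
  rw [hl] at hE
  obtain ⟨x₁, x₂, x₃, z₁, z₂, es⟩ := hE.inv_lock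
  rw [es] at hs
  obtain ⟨y₀, y₁, y₂, y₃, y₄, y₅, y₆, y₇, rfl, rfl, rfl, e', -, -, h₂, h₃, h₄, -, h₆, -, -⟩ :=
    hs.of_state
  obtain ⟨rfl, rfl, rfl⟩ := drt_inj.1 e'
  intro S hS _ hS' S₀ hS₀ _ hS₀' m hm hmN hm' ρ₂ hρ₂ n hfree
  simp [nf_set_int, nf_set_lock, nf_stm, hns, hni, hS'] at hS hS₀ hm
  rw [es, contract_set_int_cpu] at hS
  subst hS
  rw [contract_set_lock_cpu] at hS₀
  subst hS₀
  rw [es, contract_stm] at hm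
  -- The role omits the current `PCR` value, since the reset overwrites it.
  refine ⟨.launch (cpu ff y₂) (smram y₃ y₄) (drt z₁ z₂ tt) m, nofun, nofun, ?_, ?_⟩
  · simp [-nf_state, hS₀']
    exact .inr (.reset_req (m := m) (by simp))
  intro ρ₃ hρ₃ σ₃ hne₃ hnf₃ hT₃
  simp at hne₃ hnf₃ hT₃
  have hr₃ : ρ₃ n = _ := hρ₃.apply_eq (Function.update_self ..) nofun
  have en₃ : σ₃ .nonce = .name n := by simp [hne₃]
  have em₃ : σ₃ .measure = m := by simp [hne₃]
  have ei₃ : σ₃ .init = σ₁ .init := by simp [hne₃]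
  have ep₃ : σ₃ .pp = σ₁ .pp := by simp [hne₃]
  simp [en₃, hnf₃] at hT₃
  obtain ⟨k, b, c, d, m', ek, e₁, hk'⟩ := (hT₃.priv not_known_cpu_tpm).inv_reset_resp
  cases ek
  cases hr₃.symm.trans hk'
  refine ⟨?_, ?_⟩
  · simp [hnf₃, en₃, em₃, hm']
    rw [e₁]
    exact .inr (.extend_req hr₃)
  intro ρ₄ hρ₄ σ₄ hne₄ hnf₄ hT₄
  simp at hne₄ hnf₄ hT₄
  have hr₄ := hρ₄.apply_eq hr₃ nofun
  have en₄ : σ₄ .nonce = .name n := by simp [hne₄, en₃]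
  have ei₄ : σ₄ .init = σ₁ .init := by simp [hne₄, ei₃]
  have ep₄ : σ₄ .pp = σ₁ .pp := by simp [hne₄, ep₃]
  simp [en₄, hnf₄] at hT₄
  obtain ⟨k, b, c, d, m', ek, e₂, hk'⟩ := (hT₄.priv not_known_cpu_tpm).inv_extend_resp
  cases ek
  cases hr₄.symm.trans hk'
  intro S₃ hS₃ _ hS₃' e hE heN he'
  simp [nf_set_init, nf_get_entry, hnf₄, ei₄, hni] at hS₃ hE
  rw [e₂, contract_set_init] at hS₃
  subst hS₃ hE
  have ei := (edrt_contract heN trivial).inv_get_entry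
  set e := (get_entry (σ₁ .init)).contract
  have hext₁ : ρ₁.Ext ρ₄ :=
    ((hρ₂.trans (Roles.ext_update hfree _)).trans hρ₃).trans hρ₄
  rw [ei] at hi
  have hn₄ : Known ρ₄ (.name n) := .name (hr₄ ▸ nofun) (hr₄ ▸ nofun)
  refine ⟨?_, ?_, ?_⟩
  · simp [-nf_state, hS₃', he', en₄, ei₄, ep₄, hni, hnp]
    rw [← hm, ei]
    -- If the entry point is known, the launched program is not the trusted `INIT` and the state may
    -- go public. If it is private, it is `Tinit`, where the launch value must stay hidden, or an
    -- entry point where quadruples are not accepted.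
    obtain he | ⟨j, he⟩ := hi.of_prog
    · replace he := he.mono hext₁
      refine .inl ⟨he, .tup₄ hn₄ ?_ (.tpm_ch he) (hp.mono hext₁)⟩
      refine .state (.hash _) known_ff (h₂.mono hext₁) (h₃.mono hext₁) (h₄.mono hext₁)
        (hi.mono hext₁) (h₆.mono hext₁) known_tt ⟨nofun, fun h' => ?_, fun h' => ?_⟩
      · simp at h'
        exact not_known_entry 0 (h'.1 ▸ he)
      · have := (tup2_inj.1 (h_inj.1 h')).1
        cases this
    · rw [he]
      by_cases hj : j = 0
      · subst hj
        exact .inr (.launch known_ff (h₂.mono hext₁) (h₃.mono hext₁) (h₄.mono hext₁)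
          (h₆.mono hext₁) (hp.mono hext₁))
      · exact .inr (.launch_other hj _ _ _ _)
  · simp [hni, ei₄]
    exact .inr (.ext_channel _)
  intro ρ₅ hρ₅ σ₅ hne₅ hnf₅ hT₅ e₂ hE₂ he₂N he₂'
  simp at hne₅ hnf₅ hT₅ hE₂
  simp [hnf₅, he'] at hT₅
  have hs₅ : Known ρ₅ (σ₅ .newState) := by
    by_cases hc : Known ρ₅ e
    · exact (hT₅.known hc).of_tup (2 : Fin 3)
    · obtain he | ⟨j, he⟩ := hi.of_prog
      · exact (hc (he.mono (hext₁.trans hρ₅))).elim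
      · rw [he] at hT₅ hc
        exact (hT₅.priv hc).inv_entry₃
  -- `prog e₂` is a component of the known state `newState`, so `e₂` is either known or a private
  -- entry point.
  have hpp : Known ρ₅ (prog e₂) := by
    simp [nf_get_entry, nf_pp, hnf₅] at hE₂
    subst hE₂
    have e₃ := (edrt_contract he₂N trivial).inv_get_entry
    rcases Term.contract_cases (pp (σ₅ .newState)) with hE | hE
    · rw [e₃] at hE
      obtain ⟨x₁, x₂, x₃, z₁, z₂, es⟩ := hE.inv_pp
      rw [es] at hs₅
      obtain ⟨_, _, _, _, _, _, _, _, -, -, -, e', -, -, -, -, -, -, h₆, -, -⟩ := hs₅.of_state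
      rw [(drt_inj.1 e').2.1]
      exact h₆
    · exact nomatch hE.symm.trans e₃
  refine ⟨?_, ?_, trivial⟩
  · simp [he₂', hnf₅]
    obtain hc | ⟨j, rfl⟩ := hpp.of_prog
    · exact .inl ⟨hc, .tup₂ hs₅ (.tpm_ch hc)⟩
    · by_cases hj : j = 1
      · subst hj
        exact .inr (.run hs₅)
      · exact .inr (.run_other hj _ _)
  · simp [he₂']
    exact .inr (.ext_channel _)

theorem safe_DRTproc (ρ : Roles) (σ : Subst) : Safe DRTproc ρ σ :=
  ⟨safe_TPM ρ σ, safe_CPU ρ σ, safe_INIT ρ σ, safe_SETUP ρ σ, safe_DATA ρ σ, safe_PP ρ σ⟩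

/-! ### The initial configuration and the two security properties. -/

theorem initConfig_ok {Q : Proc} (hQ : Q.IsPublic) : ∃ ρ, (initConfig DRTproc Q).Ok ρ := by
  classical
  refine ⟨fun n => if n ∈ DRTproc.names ∪ Q.names then .pub else .free,
    fun n hn => if_neg hn, nofun, fun p hp => ?_⟩
  obtain rfl := Multiset.mem_singleton.1 hp
  refine ⟨safe_DRTproc _ _, hQ.safe (fun x => .var x) fun n hn => ?_⟩
  refine .name ?_ ?_ <;> simp [hn]

theorem codeIntegrity : CodeIntegrity Edrt DRTproc := by
  rintro σ ⟨Q, hQ, C, hC, hT⟩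
  obtain ⟨ρ, hρ⟩ := initConfig_ok hQ
  obtain ⟨ρ', -, hρ'⟩ := hρ.steps hC
  have hk := hT.known hρ'.known
  simp at hk
  obtain ⟨_, _, _, _, _, _, _, _, e₀, -, e₂, e₃, -, -, -, -, -, -, -, -, hS⟩ := hk.of_state
  obtain ⟨rfl, -⟩ := smram_inj.1 e₂
  obtain ⟨rfl, rfl, -⟩ := drt_inj.1 e₃
  obtain ⟨h₁, h₂, h₃, -⟩ := hS.of_hchain (tpm_inj.1 e₀).symm
  -- Needed to pass from equal values of `nf` to `EqE`.
  have hN : NoDestructor Edrt (tup ![prog Tinit, prog Tpp, prog Tstm]) := by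
    have hp : ∀ i, NoDestructor Edrt (prog (K (.entry i))) := fun i =>
      ⟨fun hd => (isDestructor_iff .prog).1 hd, fun k : Fin 1 => by
        fin_cases k
        exact noDestructor_const rfl⟩
    exact ⟨fun hd => (isDestructor_iff (.tup 3)).1 hd, fun i : Fin 3 => by
      fin_cases i <;> exact hp _⟩
  refine .of_nf_eq ?_ ?_
  · simpa [h₁, h₂, h₃] using hN
  · simp [h₁, h₂, h₃]

/-- The name gets the role `.key` when it is created and keeps it under every extension of the
roles, while known names never have this role. -/
theorem keySecrecy : KeySecrecy Edrt DRTproc := by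
  rintro ⟨Q, hQ, N, M, Ps, σ, n, C, hC₁, hn, hC₂, hT⟩
  obtain ⟨ρ, hρ⟩ := initConfig_ok hQ
  obtain ⟨ρ₁, -, hρ₁⟩ := hρ.steps hC₁
  obtain ⟨ρ₂, hkey, -, hρ₂⟩ := hρ₁.new hn
  obtain ⟨ρ₃, hext, hρ₃⟩ := hρ₂.steps hC₂
  exact (hT.known hρ₃.known).of_name.2 (hext.apply_eq (hkey rfl rfl) nofun)

end DRT

theorem mainTheorem1 :
    DRT.CodeIntegrity DRT.Edrt DRT.DRTproc ∧ DRT.KeySecrecy DRT.Edrt DRT.DRTproc :=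
  ⟨DRT.codeIntegrity, DRT.keySecrecy⟩
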